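/- Let $M\subset\mathbb{R}^d$ be compact and let $\Omega$ be the set of probability measures supported on $M$ that are absolutely continuous with respect to Lebesgue measure, with the 2-Wasserstein distance $W_2$. A path $\nu:[a,b]\to\Omega$ is a (constant speed) geodesic from $\nu(a)$ to $\nu(b)$ if $W_2(\nu(s),\nu(t))=\frac{|s-t|}{b-a}\,W_2(\nu(a),\nu(b))$ for all $s,t\in[a,b]$. For a sample $(X_i,\nu_i)\in\mathbb{R}^q\times\Omega$, $i=1,\dots,n$, the global estimate at $x\in\mathbb{R}^q$ is $$\hat\mu_G(x)=\operatorname*{argmin}_{\mu\in\Omega}\frac1n\sum_{i=1}^n s_{iG}(x)\,W_2^2(\mu,\nu_i),\qquad s_{iG}(x)=1+(X_i-\bar X)^{t}\,\Sigma^{-1}(x-\bar X),$$ where $\bar X=\frac1n\sum_i X_i$, $\Sigma=\frac1n\sum_i (X_i-\bar X)(X_i-\bar X)^{t}$, and $\Sigma^{-1}$ is the Moore–Penrose inverse if $\Sigma$ is singular. Let $n=2$, with observations $(x_1,\nu_1)$ and $(x_2,\nu_2)$, where $x_1\neq x_2$ in $\mathbb{R}^q$ and $\nu_1,\nu_2\in\Omega$.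 1. (Interpolation) There is an optimal transport map $T$ from $\nu_1$ to $\nu_2$ (that is, $T_{\#}\nu_1=\nu_2$ and $\int\|x-T(x)\|^2\,d\nu_1=W_2^2(\nu_1,\nu_2)$) such that the following holds. If $M$ is convex, there is a geodesic $\nu:[0,1]\to\Omega$ from $\nu_1$ to $\nu_2$. For every geodesic $\nu:[0,1]\to\Omega$ from $\nu_1$ to $\nu_2$ and every $t\in[0,1]$, $\nu(t)$ is McCann's interpolant $((1-t)\,\mathrm{id}+tT)_{\#}\nu_1$, and $\nu(t)$ is the unique minimizer defining the global estimate at $x=x_1+t(x_2-x_1)$: $\hat\mu_G(x_1+t(x_2-x_1))=\nu(t)$. 2. (Extrapolation) Let $s_1<0$ and $s_2>1$, and suppose that the geodesic from $\nu_1$ to $\nu_2$ extends to $[s_1,s_2]$, i.e. there is $\nu:[s_1,s_2]\to\Omega$ with $\nu(0)=\nu_1$, $\nu(1)=\nu_2$ and $W_2(\nu(s),\nu(t))=|s-t|\,W_2(\nu_1,\nu_2)$ for all $s,t\in[s_1,s_2]$, and that it is the only geodesic $[s_1,s_2]\to\Omega$ connecting $\nu(s_1)$ and $\nu(s_2)$.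 Then for every $t\in[s_1,s_2]$ the unique minimizer defining the global estimate at $x=x_1+t(x_2-x_1)$ is $\nu(t)$: $\hat\mu_G(x_1+t(x_2-x_1))=\nu(t)$. -/

import Mathlib

open MeasureTheory Set
open scoped ENNReal Matrix

noncomputable section

namespace WassersteinRegression

/-! ### The space of absolutely continuous measures with the 2-Wasserstein distance -/

/-- `π` is a coupling of `μ` and `ν`: its two marginals are `μ` and `ν`. -/
def IsCoupling {d : ℕ} (μ ν : Measure (EuclideanSpace ℝ (Fin d)))
    (π : Measure (EuclideanSpace ℝ (Fin d) × EuclideanSpace ℝ (Fin d))) : Prop :=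
  π.map Prod.fst = μ ∧ π.map Prod.snd = ν

/-- The optimal quadratic transport cost `inf_π ∫ ‖x - y‖² dπ(x, y)` over all couplings. -/
def transportCost {d : ℕ} (μ ν : Measure (EuclideanSpace ℝ (Fin d))) : ℝ≥0∞ :=
  ⨅ (π : Measure (EuclideanSpace ℝ (Fin d) × EuclideanSpace ℝ (Fin d)))
    (_ : IsCoupling μ ν π), ∫⁻ p, ‖p.1 - p.2‖ₑ ^ 2 ∂π

/-- The 2-Wasserstein distance, as a real number. (For probability measures supported on a
bounded set the transport cost is finite.) -/
def W2 {d : ℕ} (μ ν : Measure (EuclideanSpace ℝ (Fin d))) : ℝ :=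
  Real.sqrt (transportCost μ ν).toReal

/-- The set `Ω` of absolutely continuous probability measures supported on `M`. -/
abbrev Omega {d : ℕ} (M : Set (EuclideanSpace ℝ (Fin d))) : Type :=
  {μ : Measure (EuclideanSpace ℝ (Fin d)) //
    IsProbabilityMeasure μ ∧ μ Mᶜ = 0 ∧ μ ≪ volume}

/-- `T` is an optimal transport map from `μ` to `ν`: it pushes `μ` forward to `ν`, and its
quadratic cost is the squared 2-Wasserstein distance. -/
def IsOptimalTransportMap {d : ℕ} (μ ν : Measure (EuclideanSpace ℝ (Fin d)))
    (T : EuclideanSpace ℝ (Fin d) → EuclideanSpace ℝ (Fin d)) : Prop :=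
  Measurable T ∧ μ.map T = ν ∧ ∫⁻ x, ‖x - T x‖ₑ ^ 2 ∂μ = transportCost μ ν

/-- McCann's displacement interpolation `((1 - t) id + t T)_# μ`. -/
def mcCann {d : ℕ} (μ : Measure (EuclideanSpace ℝ (Fin d)))
    (T : EuclideanSpace ℝ (Fin d) → EuclideanSpace ℝ (Fin d)) (t : ℝ) :
    Measure (EuclideanSpace ℝ (Fin d)) :=
  μ.map fun x => (1 - t) • x + t • T x

/-- `γ`, restricted to `[a, b]`, is a constant speed geodesic of `(Ω, W₂)` that connects
`μ = γ a` to `ν = γ b`. The values of `γ` off `[a, b]` play no role. -/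
def IsGeodesicFromTo {d : ℕ} {M : Set (EuclideanSpace ℝ (Fin d))} (a b : ℝ)
    (γ : ℝ → Omega M) (μ ν : Omega M) : Prop :=
  γ a = μ ∧ γ b = ν ∧
    ∀ s ∈ Icc a b, ∀ t ∈ Icc a b,
      W2 (γ s).1 (γ t).1 = |s - t| / (b - a) * W2 μ.1 ν.1

/-- `γ`, defined on `[s₁, s₂] ⊇ [0, 1]`, extends the geodesic `γ` on `[0, 1]` from `μ` to `ν`:
the geodesic property, with the same speed `W₂(μ, ν)`, continues to hold on `[s₁, s₂]`. -/
def IsExtendedGeodesic {d : ℕ} {M : Set (EuclideanSpace ℝ (Fin d))} (s₁ s₂ : ℝ)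
    (γ : ℝ → Omega M) (μ ν : Omega M) : Prop :=
  γ 0 = μ ∧ γ 1 = ν ∧
    ∀ s ∈ Icc s₁ s₂, ∀ t ∈ Icc s₁ s₂, W2 (γ s).1 (γ t).1 = |s - t| * W2 μ.1 ν.1

/-! ### The global model -/

/-- The Moore-Penrose inverse of a symmetric real matrix: the eigenvalues are inverted, with
`0⁻¹ = 0`. It is the usual inverse where that exists. -/
def pinv {q : ℕ} (A : Matrix (Fin q) (Fin q) ℝ) : Matrix (Fin q) (Fin q) ℝ :=
  cfc (fun r : ℝ => r⁻¹) A

/-- The sample mean. -/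
def sampleMean {n q : ℕ} (X : Fin n → EuclideanSpace ℝ (Fin q)) : EuclideanSpace ℝ (Fin q) :=
  (n : ℝ)⁻¹ • ∑ i, X i

/-- The empirical covariance matrix `Σ = n⁻¹ ∑ᵢ (Xᵢ - X̄)(Xᵢ - X̄)ᵗ`. -/
def sampleCov {n q : ℕ} (X : Fin n → EuclideanSpace ℝ (Fin q)) : Matrix (Fin q) (Fin q) ℝ :=
  (n : ℝ)⁻¹ • ∑ i, Matrix.vecMulVec (X i - sampleMean X).ofLp (X i - sampleMean X).ofLp

/-- The weights `s_{iG}(x) = 1 + (Xᵢ - X̄)ᵗ Σ⁻¹ (x - X̄)`, with the Moore-Penrose inverse, so that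
they also make sense for predictors that do not span the whole space. -/
def globalWeight {n q : ℕ} (X : Fin n → EuclideanSpace ℝ (Fin q)) (i : Fin n)
    (x : EuclideanSpace ℝ (Fin q)) : ℝ :=
  1 + (X i - sampleMean X).ofLp ⬝ᵥ (pinv (sampleCov X) *ᵥ (x - sampleMean X).ofLp)

/-- The objective `n⁻¹ ∑ᵢ s_{iG}(x) W₂²(μ, νᵢ)` of the global model. -/
def globalObjective {n q d : ℕ} {M : Set (EuclideanSpace ℝ (Fin d))}
    (X : Fin n → EuclideanSpace ℝ (Fin q)) (ν : Fin n → Omega M)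
    (x : EuclideanSpace ℝ (Fin q)) (μ : Omega M) : ℝ :=
  (n : ℝ)⁻¹ * ∑ i, globalWeight X i x * W2 μ.1 (ν i).1 ^ 2

/-- The global estimate at `x`, as the set of all minimizers over `Ω` of the objective. -/
def globalEstimate {n q d : ℕ} {M : Set (EuclideanSpace ℝ (Fin d))}
    (X : Fin n → EuclideanSpace ℝ (Fin q)) (ν : Fin n → Omega M)
    (x : EuclideanSpace ℝ (Fin q)) : Set (Omega M) :=
  {μ | ∀ μ' : Omega M, globalObjective X ν x μ ≤ globalObjective X ν x μ'}

/-! ### `pinv` is the Moore-Penrose inverse -/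

theorem sampleCov_isHermitian {n q : ℕ} (X : Fin n → EuclideanSpace ℝ (Fin q)) :
    (sampleCov X).IsHermitian := by
  ext i j
  simp [sampleCov, Matrix.sum_apply, Matrix.vecMulVec_apply, mul_comm]

theorem pinv_isHermitian {q : ℕ} (A : Matrix (Fin q) (Fin q) ℝ) : (pinv A).IsHermitian :=
  cfc_predicate (fun r : ℝ => r⁻¹) A

theorem mul_pinv_mul {q : ℕ} {A : Matrix (Fin q) (Fin q) ℝ} (hA : A.IsHermitian) :
    A * pinv A * A = A := by
  have hs : IsSelfAdjoint A := hA
  have hf : (spectrum ℝ A).Finite := Matrix.finite_real_spectrum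
  have hc : ∀ f : ℝ → ℝ, ContinuousOn f (spectrum ℝ A) := fun f => hf.continuousOn f
  have h1 : cfc (fun r : ℝ => r * r⁻¹ * r) A = A * pinv A * A := by
    rw [cfc_mul (fun r : ℝ => r * r⁻¹) (fun r => r) A (hc _) (hc _),
      cfc_mul (fun r : ℝ => r) (fun r => r⁻¹) A (hc _) (hc _), cfc_id' ℝ A, pinv]
  rw [← h1]
  simp [cfc_id' ℝ A]

theorem pinv_mul_pinv {q : ℕ} {A : Matrix (Fin q) (Fin q) ℝ} (hA : A.IsHermitian) :
    pinv A * A * pinv A = pinv A := by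
  have hs : IsSelfAdjoint A := hA
  have hf : (spectrum ℝ A).Finite := Matrix.finite_real_spectrum
  have hc : ∀ f : ℝ → ℝ, ContinuousOn f (spectrum ℝ A) := fun f => hf.continuousOn f
  have h1 : cfc (fun r : ℝ => r⁻¹ * r * r⁻¹) A = pinv A * A * pinv A := by
    rw [cfc_mul (fun r : ℝ => r⁻¹ * r) (fun r => r⁻¹) A (hc _) (hc _),
      cfc_mul (fun r : ℝ => r⁻¹) (fun r => r) A (hc _) (hc _), cfc_id' ℝ A, pinv]
  have h2 : (fun r : ℝ => r⁻¹ * r * r⁻¹) = fun r => r⁻¹ := by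
    funext r
    by_cases hr : r = 0
    · simp [hr]
    · simp [hr]
  rw [← h1, h2, pinv]

theorem mul_pinv_comm {q : ℕ} {A : Matrix (Fin q) (Fin q) ℝ} (hA : A.IsHermitian) :
    A * pinv A = pinv A * A := by
  have hs : IsSelfAdjoint A := hA
  have h := cfc_commute_cfc (fun r : ℝ => r) (fun r : ℝ => r⁻¹) A
  rwa [cfc_id' ℝ A] at h

theorem pinv_eq_inv {q : ℕ} {A : Matrix (Fin q) (Fin q) ℝ} (hA : A.IsHermitian)
    (hu : IsUnit A.det) : pinv A = A⁻¹ := by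
  have h := mul_pinv_mul hA
  have h2 : A * pinv A = 1 := by
    have := congrArg (· * A⁻¹) h
    simpa [Matrix.mul_assoc, Matrix.mul_nonsing_inv A hu] using this
  exact (Matrix.inv_eq_right_inv h2).symm

end WassersteinRegression

end

/-! For two observations the covariance is a multiple of v vᵗ with v = x₂ - x₁, and the objective at
parameter t becomes (1 - t) a² + t b², where a, b are the distances from μ to ν₁, ν₂. With w =
W₂(ν₁, ν₂), the triangle inequalities give (1 - t) a² + t b² ≥ t (1 - t) w² for every real t, with
equality only if a = |t| w and b = |1 - t| w. A geodesic point ν(t) has these distances, so it is a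
minimizer.

Uniqueness needs that the two distances determine the measure (`eq_mcCann_of_W2`). Equality in the
triangle inequality makes a composition of optimal maps optimal and its trajectories straight.
Solving for the missing endpoint gives McCann's interpolant, also outside [0, 1].

Everything rests on Brenier's theorem (`exists_isBrenier`). A Kantorovich potential minimizes the
dual functional; its Legendre transform is Lipschitz, hence differentiable a.e.; the first variation
says that the gradient pushes μ to ν. Complementary slackness makes this map optimal and a.e.
unique. As all measures in Ω are absolutely continuous, optimal plans between them come from maps
and compose directly. Geodesics exist for convex M because the interpolating maps are expanding up
to a factor, so the interpolants stay absolutely continuous. -/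

namespace WassersteinRegression

open Filter Topology

/-! ### Legendre transforms on a compact set -/

section Conjugate

theorem integrable_of_continuous {X : Type*} [TopologicalSpace X] [CompactSpace X]
    [MeasurableSpace X] [OpensMeasurableSpace X] {μ : Measure X} [IsFiniteMeasure μ] {f : X → ℝ}
    (hf : Continuous f) : Integrable f μ := by
  exact (BoundedContinuousFunction.mkOfCompact ⟨f, hf⟩).integrable μ

variable {E : Type*} [NormedAddCommGroup E] {M : Set E}

theorem exists_norm_bound [CompactSpace M] : ∃ R : NNReal, ∀ y ∈ M, ‖y‖ ≤ R := by
  obtain ⟨R, hR⟩ := (isCompact_iff_compactSpace.2 ‹CompactSpace M›).isBounded.exists_norm_le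
  exact ⟨R.toNNReal, fun y hy => (hR y hy).trans (Real.le_coe_toNNReal R)⟩

/-- By equicontinuity it suffices to have compactness for pointwise convergence. There the set is
closed in a product of intervals, whose lengths are bounded through the normalization at `y₀`. -/
theorem isCompact_lipschitz_normalized [CompactSpace M] (R : NNReal) (y₀ : M) :
    IsCompact {g : C(M, ℝ) | LipschitzWith R g ∧ g y₀ = 0} := by
  refine ArzelaAscoli.isCompact_of_equicontinuous _ ?_ ?_
  · have himg : ContinuousMap.toFun '' {g : C(M, ℝ) | LipschitzWith R g ∧ g y₀ = 0} =
        {f : M → ℝ | LipschitzWith R f} ∩ {f | f y₀ = 0} := by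
      ext f
      constructor
      · rintro ⟨g, hg, rfl⟩
        exact hg
      · intro hf
        exact ⟨⟨f, hf.1.continuous⟩, hf, rfl⟩
    rw [himg]
    refine (isCompact_univ_pi (s := fun y : M => Icc (-(R * dist y y₀)) (R * dist y y₀))
      fun y => isCompact_Icc).of_isClosed_subset ?_ ?_
    · refine IsClosed.inter ?_ (isClosed_eq (continuous_apply y₀) continuous_const)
      simp only [lipschitzWith_iff_dist_le_mul, ofPred_forall]
      exact isClosed_iInter fun x => isClosed_iInter fun y =>
        isClosed_le ((continuous_apply x).dist (continuous_apply y)) continuous_const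
    · rintro f ⟨hf, hf0 : f y₀ = 0⟩ y -
      have := hf.dist_le_mul y y₀
      rw [hf0, dist_zero_right, Real.norm_eq_abs] at this
      exact abs_le.1 this
  · exact (LipschitzWith.uniformEquicontinuous _ R fun g => g.2.1).equicontinuous

variable [InnerProductSpace ℝ E]

/-- The Legendre transform `x ↦ sup_{y ∈ M} ⟪x, y⟫ - g y` of a function on `M`. -/
noncomputable def conj (g : C(M, ℝ)) (x : E) : ℝ := ⨆ y : M, (inner ℝ x (y : E) - g y)

theorem bddAbove_conj [CompactSpace M] (g : C(M, ℝ)) (x : E) :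
    BddAbove (range fun y : M => inner ℝ x (y : E) - g y) :=
  (isCompact_range (by fun_prop)).bddAbove

theorem le_conj [CompactSpace M] (g : C(M, ℝ)) (x : E) (y : M) :
    inner ℝ x (y : E) - g y ≤ conj g x :=
  le_ciSup (bddAbove_conj g x) y

theorem exists_conj_eq [CompactSpace M] [Nonempty M] (g : C(M, ℝ)) (x : E) :
    ∃ y : M, conj g x = inner ℝ x (y : E) - g y := by
  obtain ⟨y, -, hy⟩ := isCompact_univ.exists_isMaxOn (univ_nonempty (α := M))
    (f := fun y : M => inner ℝ x (y : E) - g y) (by fun_prop)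
  exact ⟨y, le_antisymm (ciSup_le fun z => hy (mem_univ z)) (le_conj g x y)⟩

theorem conj_le_iff [CompactSpace M] [Nonempty M] {g : C(M, ℝ)} {x : E} {a : ℝ} :
    conj g x ≤ a ↔ ∀ y : M, inner ℝ x (y : E) - g y ≤ a :=
  ciSup_le_iff (bddAbove_conj g x)

theorem lipschitzWith_conj [CompactSpace M] [Nonempty M] {R : NNReal}
    (hR : ∀ y ∈ M, ‖y‖ ≤ R) (g : C(M, ℝ)) : LipschitzWith R (conj g) := by
  refine LipschitzWith.of_le_add_mul R fun x x' => ?_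
  obtain ⟨y, hy⟩ := exists_conj_eq g x
  have h1 := le_conj g x' y
  have h2 : inner ℝ (x - x') (y : E) ≤ R * dist x x' := by
    refine (real_inner_le_norm _ _).trans ?_
    rw [dist_eq_norm, mul_comm]
    exact mul_le_mul_of_nonneg_right (hR y y.2) (norm_nonneg _)
  rw [inner_sub_left] at h2
  linarith

theorem continuous_conj [CompactSpace M] [Nonempty M] (g : C(M, ℝ)) : Continuous (conj g) := by
  obtain ⟨R, hR⟩ := exists_norm_bound (M := M)
  exact (lipschitzWith_conj hR g).continuous

theorem conj_le_conj_add_norm [CompactSpace M] [Nonempty M] (g h : C(M, ℝ)) (x : E) :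
    conj g x ≤ conj h x + ‖g - h‖ := by
  refine conj_le_iff.2 fun y => ?_
  have h1 := le_conj h x y
  have h2 := neg_le_of_abs_le ((g - h).norm_coe_le_norm y)
  rw [ContinuousMap.sub_apply] at h2
  linarith

theorem abs_conj_sub_conj_le [CompactSpace M] [Nonempty M] (g h : C(M, ℝ)) (x : E) :
    |conj g x - conj h x| ≤ ‖g - h‖ := by
  have h1 := conj_le_conj_add_norm g h x
  have h2 := conj_le_conj_add_norm h g x
  rw [norm_sub_rev] at h2
  exact abs_sub_le_iff.2 ⟨by linarith, by linarith⟩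

/-- The function `conj g z - ⟪z, y⟫` is at least `-g y` for all `z`, with equality at `x`, so its
derivative vanishes there. Differentiability thus forces a unique maximizer. -/
theorem gradient_conj [CompactSpace M] [CompleteSpace E] {g : C(M, ℝ)} {x : E} {y : M}
    (hd : DifferentiableAt ℝ (conj g) x) (hy : conj g x = inner ℝ x (y : E) - g y) :
    gradient (conj g) x = y := by
  have hmin : IsLocalMin (fun z => conj g z - innerSL ℝ (y : E) z) x := by
    refine Eventually.of_forall fun z => ?_
    have := le_conj g z y
    simp only [innerSL_apply_apply, real_inner_comm]
    linarith
  have h0 := hmin.hasFDerivAt_eq_zero (hd.hasFDerivAt.sub (innerSL ℝ (y : E)).hasFDerivAt)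
  rw [gradient, sub_eq_zero.1 h0]
  exact (InnerProductSpace.toDual ℝ E).symm_apply_apply (y : E)

/-- The Legendre transform, as a continuous function on `M`. -/
noncomputable def conjMap [CompactSpace M] [Nonempty M] (g : C(M, ℝ)) : C(M, ℝ) :=
  ⟨fun x => conj g x, (continuous_conj g).comp continuous_subtype_val⟩

theorem conjMap_apply [CompactSpace M] [Nonempty M] (g : C(M, ℝ)) (x : M) :
    conjMap g x = conj g x := rfl

theorem conj_conjMap_le [CompactSpace M] [Nonempty M] (g : C(M, ℝ)) (y : M) :
    conj (conjMap g) y ≤ g y := by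
  refine conj_le_iff.2 fun x => ?_
  have := le_conj g x y
  rw [conjMap_apply, real_inner_comm]
  linarith

theorem conj_antitone [CompactSpace M] [Nonempty M] {g h : C(M, ℝ)} (hgh : ∀ y, g y ≤ h y)
    (x : E) : conj h x ≤ conj g x := by
  refine conj_le_iff.2 fun y => ?_
  have := le_conj g x y
  have := hgh y
  linarith

theorem conj_conjMap_conjMap [CompactSpace M] [Nonempty M] (g : C(M, ℝ)) (x : M) :
    conj (conjMap (conjMap g)) x ≤ conj g x :=
  conj_conjMap_le (conjMap g) x

theorem conj_sub_const [CompactSpace M] [Nonempty M] (g : C(M, ℝ)) (a : ℝ) (x : E) :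
    conj (g - ContinuousMap.const M a) x = conj g x + a := by
  refine le_antisymm (conj_le_iff.2 fun y => ?_) ?_
  · have := le_conj g x y
    simp only [ContinuousMap.sub_apply, ContinuousMap.const_apply]
    linarith
  · rw [← le_sub_iff_add_le]
    refine conj_le_iff.2 fun y => ?_
    have := le_conj (g - ContinuousMap.const M a) x y
    simp only [ContinuousMap.sub_apply, ContinuousMap.const_apply] at this
    linarith

/-! ### The Kantorovich dual problem -/

section Dual

variable [MeasurableSpace E] [BorelSpace E]

/-- The Kantorovich dual functional. -/
noncomputable def dualFunctional (μ ν : Measure M) (g : C(M, ℝ)) : ℝ :=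
  ∫ x : M, conj g x ∂μ + ∫ y, g y ∂ν

theorem integrable_conj [CompactSpace M] [Nonempty M] {μ : Measure M} [IsFiniteMeasure μ]
    (g : C(M, ℝ)) : Integrable (fun x : M => conj g x) μ :=
  integrable_of_continuous (conjMap g).continuous

variable [CompactSpace M] [Nonempty M] (μ ν : Measure M) [IsProbabilityMeasure μ]
  [IsProbabilityMeasure ν]

theorem continuous_dualFunctional : Continuous (dualFunctional μ ν) := by
  refine Continuous.add ?_ ?_
  · refine (LipschitzWith.of_dist_le_mul (K := 1) fun g h => ?_).continuous
    rw [Real.dist_eq, ← integral_sub (integrable_conj g) (integrable_conj h), dist_eq_norm]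
    have := norm_integral_le_of_norm_le_const (μ := μ) (C := ‖g - h‖)
      (f := fun x : M => conj g x - conj h x)
      (ae_of_all _ fun x => abs_conj_sub_conj_le g h x)
    simpa using this
  · refine (LipschitzWith.of_dist_le_mul (K := 1) fun g h => ?_).continuous
    rw [Real.dist_eq, ← integral_sub (integrable_of_continuous g.continuous)
      (integrable_of_continuous h.continuous), dist_eq_norm]
    have := norm_integral_le_of_norm_le_const (μ := ν) (C := ‖g - h‖) (f := fun y : M => g y - h y)
      (ae_of_all _ fun x => (g - h).norm_coe_le_norm x)
    simpa using this

theorem dualFunctional_sub_const (g : C(M, ℝ)) (a : ℝ) :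
    dualFunctional μ ν (g - ContinuousMap.const M a) = dualFunctional μ ν g := by
  simp only [dualFunctional, conj_sub_const, ContinuousMap.sub_apply, ContinuousMap.const_apply]
  rw [integral_add (integrable_conj g) (integrable_const a),
    integral_sub (integrable_of_continuous g.continuous) (integrable_const a)]
  simp

theorem dualFunctional_conjMap_conjMap_le (g : C(M, ℝ)) :
    dualFunctional μ ν (conjMap (conjMap g)) ≤ dualFunctional μ ν g :=
  add_le_add
    (integral_mono (integrable_conj _) (integrable_conj _) (conj_conjMap_conjMap g))
    (integral_mono (integrable_conj _) (integrable_of_continuous g.continuous) (conj_conjMap_le g))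

/-- Double conjugation does not increase the functional and makes every candidate `R`-Lipschitz;
subtracting a constant does not change the value. So the compact set of normalized Lipschitz
functions contains a minimizer. -/
theorem exists_dualFunctional_minimizer :
    ∃ g : C(M, ℝ), ∀ h, dualFunctional μ ν g ≤ dualFunctional μ ν h := by
  obtain ⟨R, hR⟩ := exists_norm_bound (M := M)
  obtain ⟨y₀⟩ := ‹Nonempty M›
  obtain ⟨g, -, hg⟩ := (isCompact_lipschitz_normalized R y₀).exists_isMinOn
    ⟨0, LipschitzWith.const' (K := R) (0 : ℝ), rfl⟩
    (continuous_dualFunctional μ ν).continuousOn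
  refine ⟨g, fun h => ?_⟩
  set k := conjMap (conjMap h) with hk
  have hmem : k - ContinuousMap.const M (k y₀) ∈
      {g : C(M, ℝ) | LipschitzWith R g ∧ g y₀ = 0} := by
    refine ⟨LipschitzWith.of_dist_le_mul fun x y => ?_, by simp⟩
    simp only [ContinuousMap.sub_apply, ContinuousMap.const_apply, dist_sub_right]
    exact (lipschitzWith_conj hR (conjMap h)).dist_le_mul x y
  calc dualFunctional μ ν g ≤ dualFunctional μ ν (k - ContinuousMap.const M (k y₀)) := hg hmem
    _ = dualFunctional μ ν k := dualFunctional_sub_const μ ν k _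
    _ ≤ dualFunctional μ ν h := dualFunctional_conjMap_conjMap_le μ ν h

end Dual

end Conjugate

/-! ### First variation of the dual functional -/

section Perturbation

variable {E : Type*} [NormedAddCommGroup E] [InnerProductSpace ℝ E] {M : Set E}

/-- An envelope theorem: the difference quotient is squeezed between `-h y` and `-h (z n)`, with `z
n` a maximizer of the perturbed problem. Compactness and uniqueness of `y` force `z n` to converge
to `y`. -/
theorem tendsto_conj_add_smul [CompactSpace M] (g h : C(M, ℝ)) {x : E} {y : M}
    (hy : conj g x = inner ℝ x (y : E) - g y)
    (huniq : ∀ z : M, conj g x = inner ℝ x (z : E) - g z → z = y)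
    {ε : ℕ → ℝ} (hε : ∀ n, 0 < ε n) (hε0 : Tendsto ε atTop (𝓝 0)) :
    Tendsto (fun n => (conj (g + ε n • h) x - conj g x) / ε n) atTop (𝓝 (-h y)) := by
  have : Nonempty M := ⟨y⟩
  choose z hz using fun n => exists_conj_eq (g + ε n • h) x
  simp only [ContinuousMap.add_apply, ContinuousMap.smul_apply, smul_eq_mul] at hz
  have hlower : ∀ n, conj g x - ε n * h y ≤ conj (g + ε n • h) x := fun n => by
    have := le_conj (g + ε n • h) x y
    simp only [ContinuousMap.add_apply, ContinuousMap.smul_apply, smul_eq_mul] at this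
    linarith
  have hupper : ∀ n, conj (g + ε n • h) x ≤ conj g x - ε n * h (z n) := fun n => by
    have := le_conj g x (z n)
    linarith [hz n]
  -- The perturbation is evaluated at both `y` and `z n`, each time costing at most `ε n * ‖h‖`.
  have hval : Tendsto (fun n => inner ℝ x (z n : E) - g (z n)) atTop (𝓝 (conj g x)) := by
    refine tendsto_of_tendsto_of_tendsto_of_le_of_le (g := fun n => conj g x - ε n * (2 * ‖h‖))
      (h := fun _ => conj g x) ?_ tendsto_const_nhds (fun n => ?_) (fun n => le_conj g x (z n))
    · simpa using tendsto_const_nhds.sub (hε0.mul_const (2 * ‖h‖))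
    · have h1 := mul_le_mul_of_nonneg_left ((abs_le.1 (h.norm_coe_le_norm y)).2) (hε n).le
      have h2 := mul_le_mul_of_nonneg_left ((abs_le.1 (h.norm_coe_le_norm (z n))).1) (hε n).le
      have := hlower n
      have := hz n
      dsimp only
      linarith
  have hzy : Tendsto z atTop (𝓝 y) := by
    refine tendsto_nhds_of_unique_mapClusterPt fun y' hy' => huniq y' ?_
    have hc : Continuous fun w : M => inner ℝ x (w : E) - g w := by fun_prop
    have h1 := (hy'.continuousAt_comp hc.continuousAt).clusterPt
    exact (eq_of_nhds_neBot (h1.mono hval)).symm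
  refine tendsto_of_tendsto_of_tendsto_of_le_of_le (g := fun _ => -h y) (h := fun n => -h (z n))
    tendsto_const_nhds ((h.continuous.tendsto y).comp hzy).neg (fun n => ?_) (fun n => ?_)
  · rw [le_div_iff₀ (hε n)]
    linarith [hlower n]
  · dsimp only
    rw [div_le_iff₀ (hε n)]
    linarith [hupper n]

variable [MeasurableSpace E] [BorelSpace E] [CompactSpace M] (μ ν : Measure M)
  [IsProbabilityMeasure μ] [IsProbabilityMeasure ν]

/-- The difference quotients of the dual functional at a minimizer are nonnegative; their limit is
`∫ h dν - ∫ h ∘ T dμ`. Replacing `h` by `-h` later gives equality. -/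
theorem integral_le_integral_of_minimizer {g : C(M, ℝ)}
    (hg : ∀ h, dualFunctional μ ν g ≤ dualFunctional μ ν h) {T : M → M}
    (hT : ∀ᵐ x : M ∂μ, conj g x = inner ℝ (x : E) (T x : E) - g (T x) ∧
      ∀ z : M, conj g x = inner ℝ (x : E) (z : E) - g z → z = T x) (h : C(M, ℝ)) :
    ∫ x, h (T x) ∂μ ≤ ∫ y, h y ∂ν := by
  have : Nonempty M := nonempty_of_isProbabilityMeasure μ
  set ε : ℕ → ℝ := fun n => 1 / ((n : ℝ) + 1) with hεdef
  have hε : ∀ n, 0 < ε n := fun n => by positivity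
  have hlim := tendsto_integral_of_dominated_convergence (μ := μ)
    (F := fun n (x : M) => (conj (g + ε n • h) x - conj g x) / ε n)
    (f := fun x => -h (T x)) (fun _ => ‖h‖)
    (fun n => (((integrable_conj _).sub (integrable_conj g)).div_const _).aestronglyMeasurable)
    (integrable_const _)
    (fun n => ae_of_all _ fun x => by
      have := abs_conj_sub_conj_le (g + ε n • h) g (x : E)
      rw [add_sub_cancel_left, norm_smul, Real.norm_eq_abs, abs_of_pos (hε n)] at this
      rw [Real.norm_eq_abs, abs_div, abs_of_pos (hε n), div_le_iff₀ (hε n)]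
      linarith)
    (hT.mono fun x hx => tendsto_conj_add_smul g h hx.1 hx.2 hε
      tendsto_one_div_add_atTop_nhds_zero_nat)
  have hbound : ∀ n, -∫ y, h y ∂ν ≤ ∫ x : M, (conj (g + ε n • h) x - conj g x) / ε n ∂μ := by
    intro n
    rw [integral_div, integral_sub (integrable_conj _) (integrable_conj _), le_div_iff₀ (hε n)]
    have h1 := hg (g + ε n • h)
    have h2 : ∫ y, (g + ε n • h) y ∂ν = ∫ y, g y ∂ν + ε n * ∫ y, h y ∂ν := by
      simp only [ContinuousMap.add_apply, ContinuousMap.smul_apply, smul_eq_mul]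
      rw [integral_add (integrable_of_continuous g.continuous)
        ((integrable_of_continuous h.continuous).const_mul _), integral_const_mul]
    rw [dualFunctional, dualFunctional, h2] at h1
    linarith
  have := ge_of_tendsto' hlim hbound
  rw [integral_neg] at this
  linarith

theorem integral_eq_integral_of_minimizer {g : C(M, ℝ)}
    (hg : ∀ h, dualFunctional μ ν g ≤ dualFunctional μ ν h) {T : M → M}
    (hT : ∀ᵐ x : M ∂μ, conj g x = inner ℝ (x : E) (T x : E) - g (T x) ∧
      ∀ z : M, conj g x = inner ℝ (x : E) (z : E) - g z → z = T x) (h : C(M, ℝ)) :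
    ∫ x, h (T x) ∂μ = ∫ y, h y ∂ν := by
  refine le_antisymm (integral_le_integral_of_minimizer μ ν hg hT h) ?_
  have := integral_le_integral_of_minimizer μ ν hg hT (-h)
  simpa [integral_neg] using this

end Perturbation

/-! ### Brenier's theorem -/

section Brenier

variable {E : Type*} [NormedAddCommGroup E] [InnerProductSpace ℝ E] [FiniteDimensional ℝ E]
  [MeasurableSpace E] [BorelSpace E]

/-- The Kantorovich potentials `f, g` and the Brenier map `T` from `μ` to `ν`. -/
structure IsBrenier (M : Set E) (μ ν : Measure E) (f g : E → ℝ) (T : E → E) : Prop where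
  continuous_left : Continuous f
  continuous_right : Continuous g
  measurable : Measurable T
  map_eq : μ.map T = ν
  inner_le : ∀ x ∈ M, ∀ y ∈ M, inner ℝ x y ≤ f x + g y
  eq_inner : ∀ᵐ x ∂μ, f x + g (T x) = inner ℝ x (T x)
  eq_of_eq_inner : ∀ᵐ x ∂μ, ∀ y ∈ M, f x + g y = inner ℝ x y → y = T x

theorem exists_isBrenier {M : Set E} (hM : IsCompact M) (μ ν : Measure E)
    [IsProbabilityMeasure μ] [IsProbabilityMeasure ν] (hμM : μ Mᶜ = 0) (hνM : ν Mᶜ = 0)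
    (lam : Measure E) [lam.IsAddHaarMeasure] (hμ : μ ≪ lam) :
    ∃ f g T, IsBrenier M μ ν f g T := by
  have : CompactSpace M := isCompact_iff_compactSpace.1 hM
  -- The potentials live on the compact space `M`, so the measures are pulled back to it; nothing is
  -- lost, as they give no mass to the complement.
  have hmap : ∀ ρ : Measure E, ρ Mᶜ = 0 → (ρ.comap (Subtype.val : M → E)).map Subtype.val = ρ := fun ρ hρ => by
    rw [map_comap_subtype_coe hM.measurableSet, Measure.restrict_eq_self_of_ae_mem]
    exact mem_ae_iff.2 hρ
  have hprob : ∀ ρ : Measure E, IsProbabilityMeasure ρ → ρ Mᶜ = 0 →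
      IsProbabilityMeasure (ρ.comap (Subtype.val : M → E)) := fun ρ h1 h2 => by
    have : IsProbabilityMeasure ((ρ.comap (Subtype.val : M → E)).map Subtype.val) := by rwa [hmap ρ h2]
    exact Measure.isProbabilityMeasure_of_map (f := (Subtype.val : M → E))
  set μ' : Measure M := μ.comap (Subtype.val : M → E) with hμ'
  set ν' : Measure M := ν.comap (Subtype.val : M → E) with hν'
  have : IsProbabilityMeasure μ' := hprob μ ‹_› hμM
  have : IsProbabilityMeasure ν' := hprob ν ‹_› hνM
  have : Nonempty M := nonempty_of_isProbabilityMeasure μ'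
  obtain ⟨k, hk⟩ := exists_dualFunctional_minimizer μ' ν'
  -- The double conjugate is still a minimizer and equals its own double conjugate on `M`, so `conj
  -- (conjMap g)` extends it continuously to the whole space.
  set g : C(M, ℝ) := conjMap (conjMap k) with hgk
  have hg : ∀ h, dualFunctional μ' ν' g ≤ dualFunctional μ' ν' h := fun h =>
    (dualFunctional_conjMap_conjMap_le μ' ν' k).trans (hk h)
  have hgg : ∀ y : M, conj (conjMap g) y = g y := fun y =>
    le_antisymm (conj_conjMap_le g y) (conj_antitone (g := conjMap g) (h := conjMap k) (conj_conjMap_conjMap k) (y : E))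
  obtain ⟨R, hR⟩ := exists_norm_bound (M := M)
  have hdiff : ∀ᵐ x ∂μ, DifferentiableAt ℝ (conj g) x :=
    hμ.ae_le (lipschitzWith_conj hR g).ae_differentiableAt
  have hmax : ∀ᵐ x ∂μ, ∀ z : M, conj g x = inner ℝ x (z : E) - g z →
      gradient (conj g) x = z := hdiff.mono fun x hx z hz => gradient_conj hx hz
  have hmeas : Measurable (gradient (conj g)) :=
    (InnerProductSpace.toDual ℝ E).symm.continuous.measurable.comp (measurable_fderiv ℝ (conj g))
  -- The choice `S` of maximizers need not be measurable; the gradient is, and the two agree a.e.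
  choose S hS using fun x => exists_conj_eq g x
  have hmax' : ∀ᵐ x : M ∂μ', ∀ z : M, conj g x = inner ℝ (x : E) (z : E) - g z →
      gradient (conj g) x = z := by
    refine ae_of_ae_map (f := (Subtype.val : M → E))
      (p := fun x => ∀ z : M, conj g x = inner ℝ x (z : E) - g z → gradient (conj g) x = z)
      measurable_subtype_coe.aemeasurable ?_
    rwa [hmap μ hμM]
  have hpush : μ.map (gradient (conj g)) = ν := by
    have : IsProbabilityMeasure (μ.map (gradient (conj g))) :=
      Measure.isProbabilityMeasure_map hmeas.aemeasurable
    refine ext_of_forall_integral_eq_of_IsFiniteMeasure fun h => ?_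
    have key := integral_eq_integral_of_minimizer μ' ν' hg (T := fun x => S x)
      (hmax'.mono fun x hx => ⟨hS x, fun z hz => Subtype.ext ((hx z hz).symm.trans (hx _ (hS x)))⟩)
      (⟨fun y => h y, h.continuous.comp continuous_subtype_val⟩ : C(M, ℝ))
    simp only [ContinuousMap.coe_mk] at key
    rw [integral_map hmeas.aemeasurable h.continuous.aestronglyMeasurable]
    conv_lhs => rw [← hmap μ hμM]
    conv_rhs => rw [← hmap ν hνM]
    rw [integral_map (f := fun x => h (gradient (conj g) x))
        measurable_subtype_coe.aemeasurable (h.continuous.measurable.comp hmeas).aestronglyMeasurable,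
      integral_map measurable_subtype_coe.aemeasurable h.continuous.aestronglyMeasurable, ← key]
    refine integral_congr_ae (hmax'.mono fun x hx => ?_)
    dsimp only
    rw [hx _ (hS x)]
  have hin : ∀ x ∈ M, ∀ y ∈ M, inner ℝ x y ≤ conj g x + conj (conjMap g) y := fun x hx y _ => by
    have := le_conj (conjMap g) y ⟨x, hx⟩
    rw [conjMap_apply, real_inner_comm] at this
    linarith
  have hμmem : ∀ᵐ x ∂μ, x ∈ M := mem_ae_iff.2 hμM
  refine ⟨conj g, conj (conjMap g), gradient (conj g), continuous_conj g, continuous_conj _, hmeas,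
    hpush, hin, ?_, ?_⟩
  · filter_upwards [hmax, hμmem] with x hx hxM
    rw [hx _ (hS x)]
    linarith [hS x, hgg (S x)]
  · filter_upwards [hdiff, hμmem] with x hx hxM y hy hxy
    rw [hgg ⟨y, hy⟩] at hxy
    exact (gradient_conj (y := ⟨y, hy⟩) hx (by linarith)).symm

end Brenier

/-! ### Couplings and transport cost on Ω -/

theorem integrable_of_continuous_of_ae_mem {X : Type*} [TopologicalSpace X] [T2Space X]
    [MeasurableSpace X] [BorelSpace X] {μ : Measure X} [IsFiniteMeasure μ] {K : Set X}
    (hK : IsCompact K) (hμ : ∀ᵐ x ∂μ, x ∈ K) {f : X → ℝ} (hf : Continuous f) :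
    Integrable f μ := by
  have := hf.continuousOn.integrableOn_compact (μ := μ) hK
  rwa [IntegrableOn, Measure.restrict_eq_self_of_ae_mem hμ] at this

theorem lintegral_enorm_sq_eq_ofReal {X F : Type*} [MeasurableSpace X] [NormedAddCommGroup F]
    {μ : Measure X} {u : X → F} (hu : Integrable (fun x => ‖u x‖ ^ 2) μ) :
    ∫⁻ x, ‖u x‖ₑ ^ 2 ∂μ = ENNReal.ofReal (∫ x, ‖u x‖ ^ 2 ∂μ) := by
  rw [ofReal_integral_eq_lintegral_ofReal hu (ae_of_all _ fun x => by positivity)]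
  refine lintegral_congr fun x => ?_
  rw [ENNReal.ofReal_pow (norm_nonneg _), ofReal_norm]

variable {d : ℕ} {M : Set (EuclideanSpace ℝ (Fin d))}

instance (α : Omega M) : IsProbabilityMeasure α.1 := α.2.1

theorem Omega.ae_mem (α : Omega M) : ∀ᵐ x ∂α.1, x ∈ M := mem_ae_iff.2 α.2.2.1

theorem IsCoupling.isProbabilityMeasure {μ ν : Measure (EuclideanSpace ℝ (Fin d))}
    [IsProbabilityMeasure μ] {π} (hπ : IsCoupling μ ν π) : IsProbabilityMeasure π := by
  have : IsProbabilityMeasure (π.map Prod.fst) := by rw [hπ.1]; infer_instance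
  exact Measure.isProbabilityMeasure_of_map (f := Prod.fst)

theorem IsCoupling.ae_mem_prod {α β : Omega M} {π} (hπ : IsCoupling α.1 β.1 π) :
    ∀ᵐ p ∂π, p ∈ M ×ˢ M := by
  have h1 : ∀ᵐ p ∂π, p.1 ∈ M := by
    refine ae_of_ae_map (f := Prod.fst) (p := (· ∈ M)) measurable_fst.aemeasurable ?_
    rw [hπ.1]
    exact α.ae_mem
  have h2 : ∀ᵐ p ∂π, p.2 ∈ M := by
    refine ae_of_ae_map (f := Prod.snd) (p := (· ∈ M)) measurable_snd.aemeasurable ?_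
    rw [hπ.2]
    exact β.ae_mem
  filter_upwards [h1, h2] with p hp1 hp2 using ⟨hp1, hp2⟩

theorem IsCoupling.integrable (hM : IsCompact M) {α β : Omega M} {π}
    (hπ : IsCoupling α.1 β.1 π)
    {h : EuclideanSpace ℝ (Fin d) × EuclideanSpace ℝ (Fin d) → ℝ} (hh : Continuous h) :
    Integrable h π := by
  have := hπ.isProbabilityMeasure
  exact integrable_of_continuous_of_ae_mem (hM.prod hM) hπ.ae_mem_prod hh

theorem isCoupling_map {X : Type*} [MeasurableSpace X] {ρ : Measure X}
    {A B : X → EuclideanSpace ℝ (Fin d)} (hA : Measurable A) (hB : Measurable B) :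
    IsCoupling (ρ.map A) (ρ.map B) (ρ.map fun x => (A x, B x)) :=
  ⟨Measure.map_map measurable_fst (hA.prodMk hB), Measure.map_map measurable_snd (hA.prodMk hB)⟩

theorem isCoupling_swap {μ ν : Measure (EuclideanSpace ℝ (Fin d))} {π}
    (hπ : IsCoupling μ ν π) : IsCoupling ν μ (π.map Prod.swap) :=
  ⟨(Measure.map_map measurable_fst measurable_swap).trans hπ.2,
    (Measure.map_map measurable_snd measurable_swap).trans hπ.1⟩

theorem transportCost_comm (μ ν : Measure (EuclideanSpace ℝ (Fin d))) :
    transportCost μ ν = transportCost ν μ := by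
  have key : ∀ μ ν : Measure (EuclideanSpace ℝ (Fin d)),
      transportCost μ ν ≤ transportCost ν μ := fun μ ν => by
    refine le_iInf₂ fun π hπ => iInf₂_le_of_le _ (isCoupling_swap hπ) ?_
    rw [lintegral_map (by fun_prop) measurable_swap]
    refine lintegral_mono fun p => ?_
    rw [Prod.fst_swap, Prod.snd_swap, ← enorm_neg, neg_sub]
  exact le_antisymm (key μ ν) (key ν μ)

theorem W2_comm (μ ν : Measure (EuclideanSpace ℝ (Fin d))) : W2 μ ν = W2 ν μ := by
  rw [W2, W2, transportCost_comm]

theorem W2_nonneg (μ ν : Measure (EuclideanSpace ℝ (Fin d))) : 0 ≤ W2 μ ν := Real.sqrt_nonneg _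

theorem W2_sq (μ ν : Measure (EuclideanSpace ℝ (Fin d))) :
    W2 μ ν ^ 2 = (transportCost μ ν).toReal := Real.sq_sqrt ENNReal.toReal_nonneg

/-- The cost of a coupling is a constant plus twice its slack in the dual constraint. -/
theorem IsCoupling.integral_norm_sub_sq (hM : IsCompact M) {α β : Omega M} {π}
    (hπ : IsCoupling α.1 β.1 π) {f g : EuclideanSpace ℝ (Fin d) → ℝ} (hf : Continuous f)
    (hg : Continuous g) :
    ∫ p, ‖p.1 - p.2‖ ^ 2 ∂π =
      ∫ x, (‖x‖ ^ 2 - 2 * f x) ∂α.1 + ∫ y, (‖y‖ ^ 2 - 2 * g y) ∂β.1 +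
        2 * ∫ p, (f p.1 + g p.2 - inner ℝ p.1 p.2) ∂π := by
  have h1 : ∫ x, (‖x‖ ^ 2 - 2 * f x) ∂α.1 = ∫ p, (‖p.1‖ ^ 2 - 2 * f p.1) ∂π := by
    rw [← hπ.1, integral_map measurable_fst.aemeasurable]
    exact Continuous.aestronglyMeasurable (by fun_prop)
  have h2 : ∫ y, (‖y‖ ^ 2 - 2 * g y) ∂β.1 = ∫ p, (‖p.2‖ ^ 2 - 2 * g p.2) ∂π := by
    rw [← hπ.2, integral_map measurable_snd.aemeasurable]
    exact Continuous.aestronglyMeasurable (by fun_prop)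
  rw [h1, h2, ← integral_const_mul, ← integral_add, ← integral_add]
  · refine integral_congr_ae (ae_of_all _ fun p => ?_)
    dsimp only
    rw [norm_sub_sq_real]
    ring
  all_goals exact hπ.integrable hM (by fun_prop)

theorem IsCoupling.lintegral_eq (hM : IsCompact M) {α β : Omega M} {π}
    (hπ : IsCoupling α.1 β.1 π) :
    ∫⁻ p, ‖p.1 - p.2‖ₑ ^ 2 ∂π = ENNReal.ofReal (∫ p, ‖p.1 - p.2‖ ^ 2 ∂π) :=
  lintegral_enorm_sq_eq_ofReal (hπ.integrable hM (by fun_prop))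

theorem W2_sq_le_of_isCoupling (hM : IsCompact M) {α β : Omega M} {π}
    (hπ : IsCoupling α.1 β.1 π) : W2 α.1 β.1 ^ 2 ≤ ∫ p, ‖p.1 - p.2‖ ^ 2 ∂π := by
  rw [W2_sq]
  refine ENNReal.toReal_le_of_le_ofReal (by positivity) ?_
  rw [← hπ.lintegral_eq hM]
  exact iInf₂_le π hπ

theorem W2_sq_le_integral (hM : IsCompact M) {α β : Omega M} {X : Type*} [MeasurableSpace X]
    {ρ : Measure X} {A B : X → EuclideanSpace ℝ (Fin d)} (hA : Measurable A) (hB : Measurable B)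
    (hα : ρ.map A = α.1) (hβ : ρ.map B = β.1) :
    W2 α.1 β.1 ^ 2 ≤ ∫ x, ‖A x - B x‖ ^ 2 ∂ρ := by
  have hπ : IsCoupling α.1 β.1 (ρ.map fun x => (A x, B x)) := hα ▸ hβ ▸ isCoupling_map hA hB
  refine (W2_sq_le_of_isCoupling hM hπ).trans_eq ?_
  rw [integral_map (hA.prodMk hB).aemeasurable]
  exact Continuous.aestronglyMeasurable (by fun_prop)

theorem integrable_comp_of_map_eq (hM : IsCompact M) {α β : Omega M} {X : Type*}
    [MeasurableSpace X] {ρ : Measure X} {A B : X → EuclideanSpace ℝ (Fin d)} (hA : Measurable A)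
    (hB : Measurable B) (hα : ρ.map A = α.1) (hβ : ρ.map B = β.1)
    {h : EuclideanSpace ℝ (Fin d) × EuclideanSpace ℝ (Fin d) → ℝ} (hh : Continuous h) :
    Integrable (fun x => h (A x, B x)) ρ := by
  have hπ : IsCoupling α.1 β.1 (ρ.map fun x => (A x, B x)) := hα ▸ hβ ▸ isCoupling_map hA hB
  exact (integrable_map_measure hh.aestronglyMeasurable (hA.prodMk hB).aemeasurable).1
    (hπ.integrable hM hh)

theorem isCoupling_graph {μ ν : Measure (EuclideanSpace ℝ (Fin d))}
    {S : EuclideanSpace ℝ (Fin d) → EuclideanSpace ℝ (Fin d)} (hS : Measurable S)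
    (h : μ.map S = ν) : IsCoupling μ ν (μ.map fun x => (x, S x)) := by
  have := isCoupling_map (ρ := μ) measurable_id hS
  rwa [Measure.map_id, h] at this

theorem lintegral_map_eq_ofReal (hM : IsCompact M) {α β : Omega M}
    {S : EuclideanSpace ℝ (Fin d) → EuclideanSpace ℝ (Fin d)} (hS : Measurable S)
    (h : α.1.map S = β.1) :
    ∫⁻ x, ‖x - S x‖ₑ ^ 2 ∂α.1 = ENNReal.ofReal (∫ x, ‖x - S x‖ ^ 2 ∂α.1) :=
  lintegral_enorm_sq_eq_ofReal (integrable_comp_of_map_eq hM (h := fun p => ‖p.1 - p.2‖ ^ 2)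
    measurable_id hS Measure.map_id h (by fun_prop))

theorem transportCost_ne_top_of_map (hM : IsCompact M) {α β : Omega M}
    {S : EuclideanSpace ℝ (Fin d) → EuclideanSpace ℝ (Fin d)} (hS : Measurable S)
    (h : α.1.map S = β.1) : transportCost α.1 β.1 ≠ ⊤ := by
  refine ne_top_of_le_ne_top (b := ∫⁻ p, ‖p.1 - p.2‖ₑ ^ 2 ∂(α.1.map fun x => (x, S x))) ?_
    (iInf₂_le _ (isCoupling_graph hS h))
  rw [(isCoupling_graph hS h).lintegral_eq hM]
  exact ENNReal.ofReal_ne_top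

theorem isOptimalTransportMap_iff (hM : IsCompact M) {α β : Omega M}
    {S : EuclideanSpace ℝ (Fin d) → EuclideanSpace ℝ (Fin d)} :
    IsOptimalTransportMap α.1 β.1 S ↔
      Measurable S ∧ α.1.map S = β.1 ∧ ∫ x, ‖x - S x‖ ^ 2 ∂α.1 = W2 α.1 β.1 ^ 2 := by
  refine and_congr_right fun hS => and_congr_right fun h => ?_
  rw [lintegral_map_eq_ofReal hM hS h, W2_sq,
    ← ENNReal.ofReal_toReal (transportCost_ne_top_of_map hM hS h),
    ENNReal.ofReal_eq_ofReal_iff (by positivity) ENNReal.toReal_nonneg,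
    ENNReal.ofReal_toReal (transportCost_ne_top_of_map hM hS h)]

theorem exists_isBrenier_omega (hM : IsCompact M) (α β : Omega M) :
    ∃ f g T, IsBrenier M α.1 β.1 f g T :=
  exists_isBrenier hM α.1 β.1 α.2.2.1 β.2.2.1 volume α.2.2.2

/-! ### Optimality and uniqueness of the Brenier map -/

section Brenier

variable {α β : Omega M} {f g : EuclideanSpace ℝ (Fin d) → ℝ}
  {T : EuclideanSpace ℝ (Fin d) → EuclideanSpace ℝ (Fin d)}

/-- Complementary slackness: the cost is a constant plus twice the integrated slack, which is zero
on the graph of `T` and nonnegative for any coupling. -/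
theorem IsBrenier.integral_le (hM : IsCompact M) (hT : IsBrenier M α.1 β.1 f g T) {π}
    (hπ : IsCoupling α.1 β.1 π) :
    ∫ x, ‖x - T x‖ ^ 2 ∂α.1 ≤ ∫ p, ‖p.1 - p.2‖ ^ 2 ∂π := by
  have hf := hT.continuous_left
  have hg := hT.continuous_right
  have hG := isCoupling_graph hT.measurable hT.map_eq
  have hmeas : Measurable fun x => (x, T x) := measurable_id.prodMk hT.measurable
  have h1 := hG.integral_norm_sub_sq hM hf hg
  rw [integral_map hmeas.aemeasurable (Continuous.aestronglyMeasurable (by fun_prop)),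
    integral_map hmeas.aemeasurable (Continuous.aestronglyMeasurable (by fun_prop)),
    integral_eq_zero_of_ae (f := fun x => f x + g (T x) - inner ℝ x (T x))
      (hT.eq_inner.mono fun x hx => sub_eq_zero.2 hx)] at h1
  rw [h1, hπ.integral_norm_sub_sq hM hf hg]
  have : 0 ≤ ∫ p, (f p.1 + g p.2 - inner ℝ p.1 p.2) ∂π :=
    integral_nonneg_of_ae (hπ.ae_mem_prod.mono fun p hp =>
      sub_nonneg.2 (hT.inner_le _ hp.1 _ hp.2))
  linarith

theorem IsBrenier.isOptimalTransportMap (hM : IsCompact M) (hT : IsBrenier M α.1 β.1 f g T) :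
    IsOptimalTransportMap α.1 β.1 T := by
  refine ⟨hT.measurable, hT.map_eq, le_antisymm (le_iInf₂ fun π hπ => ?_) ?_⟩
  · rw [lintegral_map_eq_ofReal hM hT.measurable hT.map_eq, hπ.lintegral_eq hM]
    exact ENNReal.ofReal_le_ofReal (hT.integral_le hM hπ)
  · refine iInf₂_le_of_le _ (isCoupling_graph hT.measurable hT.map_eq) ?_
    have hmeas : Measurable fun x => (x, T x) := measurable_id.prodMk hT.measurable
    rw [lintegral_map (by fun_prop) hmeas]

/-- Equal cost forces the integrated slack of `S` to vanish, so the slack is zero a.e.; for almost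
every `x`, only `T x` achieves this. -/
theorem IsBrenier.ae_eq (hM : IsCompact M) (hT : IsBrenier M α.1 β.1 f g T)
    {S : EuclideanSpace ℝ (Fin d) → EuclideanSpace ℝ (Fin d)}
    (hS : IsOptimalTransportMap α.1 β.1 S) : S =ᵐ[α.1] T := by
  have hf := hT.continuous_left
  have hg := hT.continuous_right
  have hSc := ((isOptimalTransportMap_iff hM).1 hS).2.2
  have hTc := ((isOptimalTransportMap_iff hM).1 (hT.isOptimalTransportMap hM)).2.2
  have hmeasT : Measurable fun x => (x, T x) := measurable_id.prodMk hT.measurable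
  have hmeasS : Measurable fun x => (x, S x) := measurable_id.prodMk hS.1
  have h1 := (isCoupling_graph hT.measurable hT.map_eq).integral_norm_sub_sq hM hf hg
  have h2 := (isCoupling_graph hS.1 hS.2.1).integral_norm_sub_sq hM hf hg
  rw [integral_map hmeasT.aemeasurable (Continuous.aestronglyMeasurable (by fun_prop)),
    integral_map hmeasT.aemeasurable (Continuous.aestronglyMeasurable (by fun_prop)),
    integral_eq_zero_of_ae (f := fun x => f x + g (T x) - inner ℝ x (T x))
      (hT.eq_inner.mono fun x hx => sub_eq_zero.2 hx), hTc] at h1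
  rw [integral_map hmeasS.aemeasurable (Continuous.aestronglyMeasurable (by fun_prop)),
    integral_map hmeasS.aemeasurable (Continuous.aestronglyMeasurable (by fun_prop)), hSc] at h2
  have hzero : ∫ x, (f x + g (S x) - inner ℝ x (S x)) ∂α.1 = 0 := by linarith
  have hSM : ∀ᵐ x ∂α.1, S x ∈ M := by
    refine ae_of_ae_map (p := (· ∈ M)) hS.1.aemeasurable ?_
    rw [hS.2.1]
    exact β.ae_mem
  have hnn : 0 ≤ᵐ[α.1] fun x => f x + g (S x) - inner ℝ x (S x) := by
    filter_upwards [α.ae_mem, hSM] with x hx hSx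
    exact sub_nonneg.2 (hT.inner_le _ hx _ hSx)
  have hint : Integrable (fun x => f x + g (S x) - inner ℝ x (S x)) α.1 :=
    integrable_comp_of_map_eq hM (h := fun p => f p.1 + g p.2 - inner ℝ p.1 p.2)
      measurable_id hS.1 Measure.map_id hS.2.1 (by fun_prop)
  filter_upwards [(integral_eq_zero_iff_of_nonneg_ae hnn hint).1 hzero, hSM, hT.eq_of_eq_inner]
    with x hx hSx hu
  exact hu _ hSx (sub_eq_zero.1 hx)

end Brenier

theorem exists_isOptimalTransportMap (hM : IsCompact M) (α β : Omega M) :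
    ∃ T, IsOptimalTransportMap α.1 β.1 T := by
  obtain ⟨f, g, T, hT⟩ := exists_isBrenier_omega hM α β
  exact ⟨T, hT.isOptimalTransportMap hM⟩

theorem IsOptimalTransportMap.ae_eq (hM : IsCompact M) {α β : Omega M}
    {S T : EuclideanSpace ℝ (Fin d) → EuclideanSpace ℝ (Fin d)}
    (hS : IsOptimalTransportMap α.1 β.1 S) (hT : IsOptimalTransportMap α.1 β.1 T) :
    S =ᵐ[α.1] T := by
  obtain ⟨f, g, U, hU⟩ := exists_isBrenier_omega hM α β
  exact (hU.ae_eq hM hS).trans (hU.ae_eq hM hT).symm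

/-! ### The triangle inequality and its equality case -/

theorem norm_sub_sq_div_add_norm_sub_sq_div {F : Type*} [NormedAddCommGroup F]
    [InnerProductSpace ℝ F] (x y z : F) {τ : ℝ} (h0 : 0 < τ) (h1 : τ < 1) :
    ‖x - y‖ ^ 2 / τ + ‖y - z‖ ^ 2 / (1 - τ) =
      ‖x - z‖ ^ 2 + ‖(1 - τ) • (x - y) - τ • (y - z)‖ ^ 2 / (τ * (1 - τ)) := by
  have hxz : x - z = (x - y) + (y - z) := by abel
  rw [hxz, norm_add_sq_real, norm_sub_sq_real ((1 - τ) • (x - y)), norm_smul, norm_smul,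
    inner_smul_left, inner_smul_right, mul_pow, mul_pow, Real.norm_eq_abs, Real.norm_eq_abs, sq_abs,
    sq_abs]
  have h2 : (1 - τ) ≠ 0 := by linarith
  simp only [RCLike.conj_to_real]
  field_simp
  ring

/-- The pointwise identity is integrated along `x`, `S x`, `R (S x)`. The remainder vanishes exactly
where `S x` divides the segment from `x` to `R (S x)` in the ratio `τ : 1 - τ`. -/
theorem integral_optimal_split (hM : IsCompact M) {α β γ : Omega M}
    {S R : EuclideanSpace ℝ (Fin d) → EuclideanSpace ℝ (Fin d)}
    (hS : IsOptimalTransportMap α.1 β.1 S) (hR : IsOptimalTransportMap β.1 γ.1 R)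
    {τ : ℝ} (h0 : 0 < τ) (h1 : τ < 1) :
    Integrable (fun x => ‖(1 - τ) • (x - S x) - τ • (S x - R (S x))‖ ^ 2) α.1 ∧
    W2 α.1 β.1 ^ 2 / τ + W2 β.1 γ.1 ^ 2 / (1 - τ) =
      ∫ x, ‖x - R (S x)‖ ^ 2 ∂α.1 +
        (∫ x, ‖(1 - τ) • (x - S x) - τ • (S x - R (S x))‖ ^ 2 ∂α.1) / (τ * (1 - τ)) := by
  have hRS : Measurable (R ∘ S) := hR.1.comp hS.1
  have hβ : α.1.map S = β.1 := hS.2.1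
  have hγ : α.1.map (R ∘ S) = γ.1 := by rw [← Measure.map_map hR.1 hS.1, hβ, hR.2.1]
  have hSc := ((isOptimalTransportMap_iff hM).1 hS).2.2
  have hRc := ((isOptimalTransportMap_iff hM).1 hR).2.2
  rw [← hβ, integral_map hS.1.aemeasurable
    ((show Measurable fun y => ‖y - R y‖ ^ 2 from
      (measurable_id.sub hR.1).norm.pow_const 2).aestronglyMeasurable), hβ] at hRc
  have i1 : Integrable (fun x => ‖x - S x‖ ^ 2) α.1 :=
    integrable_comp_of_map_eq hM (h := fun p => ‖p.1 - p.2‖ ^ 2)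
      measurable_id hS.1 Measure.map_id hβ (by fun_prop)
  have i2 : Integrable (fun x => ‖S x - R (S x)‖ ^ 2) α.1 :=
    integrable_comp_of_map_eq hM (h := fun p => ‖p.1 - p.2‖ ^ 2) hS.1 hRS hβ hγ (by fun_prop)
  have i3 : Integrable (fun x => ‖x - R (S x)‖ ^ 2) α.1 :=
    integrable_comp_of_map_eq hM (h := fun p => ‖p.1 - p.2‖ ^ 2)
      measurable_id hRS Measure.map_id hγ (by fun_prop)
  have hid := fun x => norm_sub_sq_div_add_norm_sub_sq_div x (S x) (R (S x)) h0 h1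
  have i4 : Integrable (fun x => ‖(1 - τ) • (x - S x) - τ • (S x - R (S x))‖ ^ 2 / (τ * (1 - τ)))
      α.1 := by
    refine (((i1.div_const τ).add (i2.div_const (1 - τ))).sub i3).congr (ae_of_all _ fun x => ?_)
    have := hid x
    simp only [Pi.add_apply, Pi.sub_apply]
    linarith
  have hpos : τ * (1 - τ) ≠ 0 := (mul_pos h0 (by linarith)).ne'
  refine ⟨(i4.mul_const (τ * (1 - τ))).congr (ae_of_all _ fun x => div_mul_cancel₀ _ hpos), ?_⟩
  rw [← hSc, ← hRc, ← integral_div, ← integral_div, ← integral_div,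
    ← integral_add (i1.div_const τ) (i2.div_const (1 - τ)), ← integral_add i3 i4]
  exact integral_congr_ae (ae_of_all _ hid)

theorem W2_sq_le_integral_comp (hM : IsCompact M) {α β γ : Omega M}
    {S R : EuclideanSpace ℝ (Fin d) → EuclideanSpace ℝ (Fin d)}
    (hS : IsOptimalTransportMap α.1 β.1 S) (hR : IsOptimalTransportMap β.1 γ.1 R) :
    W2 α.1 γ.1 ^ 2 ≤ ∫ x, ‖x - R (S x)‖ ^ 2 ∂α.1 :=
  W2_sq_le_integral hM measurable_id (hR.1.comp hS.1) Measure.map_id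
    (by rw [← hR.2.1, ← hS.2.1, Measure.map_map hR.1 hS.1]; rfl)

theorem W2_triangle (hM : IsCompact M) (α β γ : Omega M) :
    W2 α.1 γ.1 ≤ W2 α.1 β.1 + W2 β.1 γ.1 := by
  obtain ⟨S, hS⟩ := exists_isOptimalTransportMap hM α β
  obtain ⟨R, hR⟩ := exists_isOptimalTransportMap hM β γ
  have ha := W2_nonneg α.1 β.1
  have hb := W2_nonneg β.1 γ.1
  set a := W2 α.1 β.1
  set b := W2 β.1 γ.1
  refine le_of_forall_pos_le_add fun ε hε => ?_
  have ha' : 0 < a + ε / 2 := by positivity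
  have hb' : 0 < b + ε / 2 := by positivity
  -- The choice `τ = a / (a + b)` would turn `a ^ 2 / τ + b ^ 2 / (1 - τ)` into `(a + b) ^ 2`; the
  -- `ε` keeps `τ` strictly between 0 and 1 even if `a` or `b` vanishes.
  set τ := (a + ε / 2) / (a + b + ε) with hτ
  have h0 : 0 < τ := by positivity
  have h1 : 1 - τ = (b + ε / 2) / (a + b + ε) := by
    rw [hτ]
    field_simp
    ring
  have h1' : τ < 1 := by
    have : 0 < 1 - τ := by rw [h1]; positivity
    linarith
  have h2 := (integral_optimal_split hM hS hR h0 h1').2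
  have h3 := W2_sq_le_integral_comp hM hS hR
  have h4 : 0 ≤ (∫ x, ‖(1 - τ) • (x - S x) - τ • (S x - R (S x))‖ ^ 2 ∂α.1) / (τ * (1 - τ)) :=
    div_nonneg (by positivity) (mul_nonneg h0.le (by linarith))
  have h5 : a ^ 2 / τ ≤ (a + ε / 2) * (a + b + ε) := by
    rw [hτ, div_div_eq_mul_div, div_le_iff₀ ha']
    have : a ^ 2 ≤ (a + ε / 2) ^ 2 := pow_le_pow_left₀ ha (by linarith) 2
    nlinarith
  have h6 : b ^ 2 / (1 - τ) ≤ (b + ε / 2) * (a + b + ε) := by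
    rw [h1, div_div_eq_mul_div, div_le_iff₀ hb']
    have : b ^ 2 ≤ (b + ε / 2) ^ 2 := pow_le_pow_left₀ hb (by linarith) 2
    nlinarith
  refine le_of_sq_le_sq ?_ (by positivity)
  nlinarith

/-- If `β` divides the distance from `α` to `γ` in the ratio `τ : 1 - τ`, then it does so along
the trajectories of the composition of the optimal maps, which is optimal. -/
theorem isOptimalTransportMap_comp_of_between (hM : IsCompact M) {α β γ : Omega M}
    {S R : EuclideanSpace ℝ (Fin d) → EuclideanSpace ℝ (Fin d)}
    (hS : IsOptimalTransportMap α.1 β.1 S) (hR : IsOptimalTransportMap β.1 γ.1 R)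
    {τ : ℝ} (h0 : 0 < τ) (h1 : τ < 1) (hαβ : W2 α.1 β.1 = τ * W2 α.1 γ.1)
    (hβγ : W2 β.1 γ.1 = (1 - τ) * W2 α.1 γ.1) :
    IsOptimalTransportMap α.1 γ.1 (R ∘ S) ∧
      ∀ᵐ x ∂α.1, S x = (1 - τ) • x + τ • R (S x) := by
  obtain ⟨hint, h2⟩ := integral_optimal_split hM hS hR h0 h1
  have h3 := W2_sq_le_integral_comp hM hS hR
  have hpos : 0 < τ * (1 - τ) := mul_pos h0 (by linarith)
  have h4 : 0 ≤ ∫ x, ‖(1 - τ) • (x - S x) - τ • (S x - R (S x))‖ ^ 2 ∂α.1 := by positivity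
  have h5 : W2 α.1 β.1 ^ 2 / τ + W2 β.1 γ.1 ^ 2 / (1 - τ) = W2 α.1 γ.1 ^ 2 := by
    have : 1 - τ ≠ 0 := by linarith
    rw [hαβ, hβγ]
    field_simp
    ring
  rw [h5] at h2
  have h6 := div_nonneg h4 hpos.le
  have hγ : α.1.map (R ∘ S) = γ.1 := by rw [← Measure.map_map hR.1 hS.1, hS.2.1, hR.2.1]
  have hRS : Measurable (R ∘ S) := hR.1.comp hS.1
  refine ⟨(isOptimalTransportMap_iff hM).2 ⟨hRS, hγ, ?_⟩, ?_⟩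
  · simp only [Function.comp_apply]
    linarith
  · have hz : (∫ x, ‖(1 - τ) • (x - S x) - τ • (S x - R (S x))‖ ^ 2 ∂α.1) = 0 := by
      have : (∫ x, ‖(1 - τ) • (x - S x) - τ • (S x - R (S x))‖ ^ 2 ∂α.1) / (τ * (1 - τ)) = 0 := by
        linarith
      rcases div_eq_zero_iff.1 this with h | h
      · exact h
      · exact absurd h hpos.ne'
    filter_upwards [(integral_eq_zero_iff_of_nonneg (fun x => by positivity) hint).1 hz] with x hx
    have hx' : (1 - τ) • (x - S x) - τ • (S x - R (S x)) = 0 := by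
      simpa using hx
    have : (1 - τ) • x + τ • R (S x) - S x = 0 := by
      rw [← hx']
      module
    exact (sub_eq_zero.1 this).symm

theorem eq_of_W2_eq_zero (hM : IsCompact M) {α β : Omega M} (h : W2 α.1 β.1 = 0) :
    α.1 = β.1 := by
  obtain ⟨S, hS⟩ := exists_isOptimalTransportMap hM α β
  obtain ⟨hSm, hSβ, hSc⟩ := (isOptimalTransportMap_iff hM).1 hS
  have hint : Integrable (fun x => ‖x - S x‖ ^ 2) α.1 :=
    integrable_comp_of_map_eq hM (h := fun p => ‖p.1 - p.2‖ ^ 2)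
      measurable_id hSm Measure.map_id hSβ (by fun_prop)
  rw [h, zero_pow two_ne_zero, integral_eq_zero_iff_of_nonneg (fun x => by positivity) hint] at hSc
  have : S =ᵐ[α.1] id := by
    filter_upwards [hSc] with x hx
    have : x - S x = 0 := by simpa using hx
    exact (sub_eq_zero.1 this).symm
  rw [← hSβ, Measure.map_congr this, Measure.map_id]

/-! ### McCann's interpolant is determined by two distances -/

theorem mcCann_zero (μ : Measure (EuclideanSpace ℝ (Fin d)))
    (T : EuclideanSpace ℝ (Fin d) → EuclideanSpace ℝ (Fin d)) : mcCann μ T 0 = μ := by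
  simp [mcCann]

theorem mcCann_one (μ : Measure (EuclideanSpace ℝ (Fin d)))
    (T : EuclideanSpace ℝ (Fin d) → EuclideanSpace ℝ (Fin d)) : mcCann μ T 1 = μ.map T := by
  simp [mcCann]

theorem measurable_interpolant {T : EuclideanSpace ℝ (Fin d) → EuclideanSpace ℝ (Fin d)}
    (hT : Measurable T) (t : ℝ) : Measurable fun x => (1 - t) • x + t • T x :=
  (measurable_id.const_smul (1 - t)).add (hT.const_smul t)

/-- A measure whose distances to `α` and `β` are those of the point with parameter `t` on the line
through them is McCann's interpolant, also for `t` outside `[0, 1]`. -/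
theorem eq_mcCann_of_W2 (hM : IsCompact M) {α β μ : Omega M}
    {T : EuclideanSpace ℝ (Fin d) → EuclideanSpace ℝ (Fin d)}
    (hT : IsOptimalTransportMap α.1 β.1 T) {t : ℝ} (h1 : W2 μ.1 α.1 = |t| * W2 α.1 β.1)
    (h2 : W2 μ.1 β.1 = |1 - t| * W2 α.1 β.1) : μ.1 = mcCann α.1 T t := by
  rcases lt_trichotomy t 0 with ht | rfl | ht
  -- Here `α` lies between `μ` and `β`, in the ratio `-t : 1`. The straight-line relation is solved
  -- for the starting point `x`.
  · rw [abs_of_neg ht] at h1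
    have ht1 : 0 < 1 - t := by linarith
    rw [abs_of_pos ht1] at h2
    obtain ⟨S, hS⟩ := exists_isOptimalTransportMap hM μ α
    obtain ⟨-, hST⟩ := isOptimalTransportMap_comp_of_between hM hS hT (τ := -t / (1 - t))
      (div_pos (by linarith) ht1) (by rw [div_lt_one ht1]; linarith)
      (by rw [h1, h2]; field_simp) (by rw [h2]; field_simp; ring)
    have : (fun x => (1 - t) • S x + t • T (S x)) =ᵐ[μ.1] id := by
      filter_upwards [hST] with x hx
      have h3 : 1 - -t / (1 - t) = 1 / (1 - t) := by field_simp; ring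
      have h4 := congrArg (fun y => (1 - t) • y) hx
      rw [h3, smul_add, smul_smul, smul_smul, mul_one_div_cancel ht1.ne', mul_div_cancel₀ _ ht1.ne']
        at h4
      rw [h4, id]
      module
    calc μ.1 = μ.1.map id := Measure.map_id.symm
      _ = μ.1.map (fun x => (1 - t) • S x + t • T (S x)) := (Measure.map_congr this).symm
      _ = mcCann α.1 T t := by
        rw [mcCann, ← hS.2.1, Measure.map_map (measurable_interpolant hT.1 t) hS.1]
        rfl
  · rw [mcCann_zero]
    exact eq_of_W2_eq_zero hM (by rw [h1]; simp)
  rcases lt_trichotomy t 1 with ht1 | rfl | ht1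
  -- Here `μ` lies between; the composite map is optimal from `α` to `β`, hence a.e. equal to `T`.
  · rw [abs_of_pos ht, W2_comm] at h1
    rw [abs_of_pos (by linarith)] at h2
    obtain ⟨S, hS⟩ := exists_isOptimalTransportMap hM α μ
    obtain ⟨R, hR⟩ := exists_isOptimalTransportMap hM μ β
    obtain ⟨hRS, hint⟩ := isOptimalTransportMap_comp_of_between hM hS hR ht ht1 h1 h2
    have : S =ᵐ[α.1] fun x => (1 - t) • x + t • T x := by
      filter_upwards [hint, hRS.ae_eq hM hT] with x hx hx'
      rw [hx, ← hx', Function.comp_apply]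
    rw [mcCann, ← Measure.map_congr this, hS.2.1]
  · rw [mcCann_one, hT.2.1]
    exact eq_of_W2_eq_zero hM (by rw [h2]; simp)
  -- Here `β` lies between `α` and `μ`, at the fraction `1 / t`. The relation is solved for the
  -- endpoint `R (T x)`.
  · rw [abs_of_pos ht, W2_comm] at h1
    rw [abs_of_neg (by linarith), W2_comm] at h2
    obtain ⟨R, hR⟩ := exists_isOptimalTransportMap hM β μ
    obtain ⟨hRT, hint⟩ := isOptimalTransportMap_comp_of_between hM hT hR (τ := 1 / t)
      (by positivity) (by rw [div_lt_one ht]; exact ht1)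
      (by rw [h1]; field_simp) (by rw [h1, h2]; field_simp; ring)
    have : R ∘ T =ᵐ[α.1] fun x => (1 - t) • x + t • T x := by
      filter_upwards [hint] with x hx
      have h4 := congrArg (fun y => t • y) hx
      rw [smul_add, smul_smul, smul_smul, mul_one_div_cancel ht.ne', one_smul, mul_sub,
        mul_one_div_cancel ht.ne', mul_one] at h4
      rw [h4, Function.comp_apply]
      module
    rw [mcCann, ← Measure.map_congr this, ← Measure.map_map hR.1 hT.1, hT.2.1, hR.2.1]

/-! ### Absolute continuity of interpolants and existence of geodesics -/

/-- The inverse of `F` on `F '' A` is Lipschitz and so preserves null sets. Hausdorff measure in the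
full dimension, which has the same null sets as volume, suits an inverse defined only on a subset.
-/
theorem volume_eq_zero_of_expanding {F : EuclideanSpace ℝ (Fin d) → EuclideanSpace ℝ (Fin d)}
    {A N : Set (EuclideanSpace ℝ (Fin d))} {K : NNReal}
    (hF : ∀ x ∈ A, ∀ y ∈ A, dist x y ≤ K * dist (F x) (F y)) (hN : volume N = 0) :
    volume (F ⁻¹' N ∩ A) = 0 := by
  have h1 : (volume : Measure (EuclideanSpace ℝ (Fin d))) ≪
      μH[Module.finrank ℝ (EuclideanSpace ℝ (Fin d))] := Measure.absolutelyContinuous_isAddHaarMeasure _ _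
  have h2 : μH[Module.finrank ℝ (EuclideanSpace ℝ (Fin d))] ≪
      (volume : Measure (EuclideanSpace ℝ (Fin d))) := Measure.absolutelyContinuous_isAddHaarMeasure _ _
  have hinj : InjOn F A := fun x hx y hy hxy => by
    have := hF x hx y hy
    rw [hxy, dist_self, mul_zero] at this
    exact dist_le_zero.1 this
  have hG : LipschitzOnWith K (Function.invFunOn F A) (F '' A) := by
    refine LipschitzOnWith.of_dist_le_mul ?_
    rintro _ ⟨x, hx, rfl⟩ _ ⟨y, hy, rfl⟩
    rw [hinj.leftInvOn_invFunOn hx, hinj.leftInvOn_invFunOn hy]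
    exact hF x hx y hy
  have hsub : F ⁻¹' N ∩ A ⊆ Function.invFunOn F A '' (F '' (F ⁻¹' N ∩ A)) := fun x hx =>
    ⟨F x, ⟨x, hx, rfl⟩, hinj.leftInvOn_invFunOn hx.2⟩
  refine h1 (measure_mono_null hsub ?_)
  have h3 := (hG.mono (image_mono (inter_subset_right (s := F ⁻¹' N)))).hausdorffMeasure_image_le
    (d := Module.finrank ℝ (EuclideanSpace ℝ (Fin d))) (by positivity)
  have h4 : μH[Module.finrank ℝ (EuclideanSpace ℝ (Fin d))] (F '' (F ⁻¹' N ∩ A)) = 0 :=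
    measure_mono_null (by rintro _ ⟨x, hx, rfl⟩; exact hx.1) (h2 hN)
  rw [h4, mul_zero] at h3
  exact le_zero_iff.1 h3

/-- Adding the dual constraints for the crossed pairs shows that `T` is monotone on `A`. So the
interpolating map shrinks distances at most by the factor `1 - t`, which is positive. -/
theorem IsBrenier.mcCann_absolutelyContinuous {α β : Omega M}
    {f g : EuclideanSpace ℝ (Fin d) → ℝ} {T : EuclideanSpace ℝ (Fin d) → EuclideanSpace ℝ (Fin d)}
    (hT : IsBrenier M α.1 β.1 f g T) {t : ℝ} (h0 : 0 ≤ t) (h1 : t < 1) :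
    mcCann α.1 T t ≪ volume := by
  set A := {x | x ∈ M ∧ T x ∈ M ∧ f x + g (T x) = inner ℝ x (T x)} with hA
  have hAae : ∀ᵐ x ∂α.1, x ∈ A := by
    have hTM : ∀ᵐ x ∂α.1, T x ∈ M := by
      refine ae_of_ae_map (p := (· ∈ M)) hT.measurable.aemeasurable ?_
      rw [hT.map_eq]
      exact β.ae_mem
    filter_upwards [α.ae_mem, hTM, hT.eq_inner] with x h1 h2 h3 using ⟨h1, h2, h3⟩
  have ht : 0 < 1 - t := by linarith
  have hexp : ∀ x ∈ A, ∀ y ∈ A, dist x y ≤ ((1 - t)⁻¹.toNNReal : ℝ) *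
      dist ((1 - t) • x + t • T x) ((1 - t) • y + t • T y) := by
    rintro x ⟨hx, hTx, hfx⟩ y ⟨hy, hTy, hfy⟩
    have h2 := hT.inner_le x hx _ hTy
    have h3 := hT.inner_le y hy _ hTx
    have hmono : 0 ≤ inner ℝ (x - y) (T x - T y) := by
      rw [inner_sub_left, inner_sub_right, inner_sub_right]
      linarith
    rw [Real.coe_toNNReal _ (inv_nonneg.2 ht.le), ← div_eq_inv_mul, le_div_iff₀ ht, dist_eq_norm,
      dist_eq_norm]
    have h4 : ((1 - t) • x + t • T x) - ((1 - t) • y + t • T y) =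
        (1 - t) • (x - y) + t • (T x - T y) := by module
    rw [h4]
    have h5 : (1 - t) * ‖x - y‖ ^ 2 ≤ ‖x - y‖ * ‖(1 - t) • (x - y) + t • (T x - T y)‖ := by
      refine le_trans ?_ (real_inner_le_norm _ _)
      rw [inner_add_right, inner_smul_right, inner_smul_right, real_inner_self_eq_norm_sq]
      have := mul_nonneg h0 hmono
      linarith
    rcases (norm_nonneg (x - y)).eq_or_lt with h | h
    · rw [← h, zero_mul]
      exact norm_nonneg _
    · exact le_of_mul_le_mul_left (by linarith) h
  refine Measure.AbsolutelyContinuous.mk fun N hN hN0 => ?_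
  rw [mcCann, Measure.map_apply (measurable_interpolant hT.measurable t) hN]
  have h2 := α.2.2.2 (volume_eq_zero_of_expanding hexp hN0)
  rwa [measure_inter_conull (t := A) (mem_ae_iff.1 hAae)] at h2

/-- Convexity keeps the interpolants in `M`. Coupling two of them through the same `x` bounds their
distance by `|s - t|` times the total; a strict inequality would contradict the triangle inequality
along 0, `s`, `t`, 1. -/
theorem exists_isGeodesicFromTo (hM : IsCompact M) (hconv : Convex ℝ M) (α β : Omega M) :
    ∃ γ : ℝ → Omega M, IsGeodesicFromTo 0 1 γ α β := by
  obtain ⟨f, g, T, hT⟩ := exists_isBrenier_omega hM α β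
  have hTM : ∀ᵐ x ∂α.1, T x ∈ M := by
    refine ae_of_ae_map (p := (· ∈ M)) hT.measurable.aemeasurable ?_
    rw [hT.map_eq]
    exact β.ae_mem
  have hmem : ∀ t ∈ Icc (0 : ℝ) 1, IsProbabilityMeasure (mcCann α.1 T t) ∧
      mcCann α.1 T t Mᶜ = 0 ∧ mcCann α.1 T t ≪ volume := by
    intro t ht
    have hmeas := measurable_interpolant hT.measurable t
    refine ⟨Measure.isProbabilityMeasure_map hmeas.aemeasurable, ?_, ?_⟩
    · rw [mcCann, Measure.map_apply hmeas hM.measurableSet.compl]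
      refine (show ∀ᵐ x ∂α.1, (1 - t) • x + t • T x ∈ M from ?_)
      filter_upwards [α.ae_mem, hTM] with x hx hTx
      exact hconv hx hTx (by linarith [ht.2]) ht.1 (by ring)
    · rcases ht.2.lt_or_eq with h | rfl
      · exact hT.mcCann_absolutelyContinuous ht.1 h
      · rw [mcCann_one, hT.map_eq]
        exact β.2.2.2
  classical
  set γ : ℝ → Omega M := fun t => if h : t ∈ Icc (0 : ℝ) 1 then ⟨mcCann α.1 T t, hmem t h⟩ else α
    with hγ
  have hγv : ∀ t ∈ Icc (0 : ℝ) 1, (γ t).1 = mcCann α.1 T t := fun t ht => by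
    simp only [hγ, dif_pos ht]
  have hγ0 : γ 0 = α := Subtype.ext (by rw [hγv 0 (by simp), mcCann_zero])
  have hγ1 : γ 1 = β := Subtype.ext (by rw [hγv 1 (by simp), mcCann_one, hT.map_eq])
  have hTc := ((isOptimalTransportMap_iff hM).1 (hT.isOptimalTransportMap hM)).2.2
  have hle : ∀ s ∈ Icc (0 : ℝ) 1, ∀ t ∈ Icc (0 : ℝ) 1,
      W2 (γ s).1 (γ t).1 ≤ |s - t| * W2 α.1 β.1 := by
    intro s hs t ht
    refine le_of_sq_le_sq ?_ (mul_nonneg (abs_nonneg _) (W2_nonneg _ _))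
    refine (W2_sq_le_integral hM (measurable_interpolant hT.measurable s)
      (measurable_interpolant hT.measurable t) (hγv s hs).symm (hγv t ht).symm).trans_eq ?_
    rw [mul_pow, sq_abs, ← hTc, ← integral_const_mul]
    refine integral_congr_ae (ae_of_all _ fun x => ?_)
    have : ((1 - s) • x + s • T x) - ((1 - t) • x + t • T x) = (t - s) • (x - T x) := by module
    dsimp only
    rw [this, norm_smul, mul_pow, Real.norm_eq_abs, sq_abs]
    ring
  have hmono : ∀ s ∈ Icc (0 : ℝ) 1, ∀ t ∈ Icc (0 : ℝ) 1, s ≤ t →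
      W2 (γ s).1 (γ t).1 = |s - t| * W2 α.1 β.1 := by
    intro s hs t ht hst
    refine le_antisymm (hle s hs t ht) ?_
    have h1 := W2_triangle hM α (γ s) β
    have h2 := W2_triangle hM (γ s) (γ t) β
    have h3 := hle 0 (by simp) s hs
    have h4 := hle t ht 1 (by simp)
    rw [hγ0, zero_sub, abs_neg, abs_of_nonneg hs.1] at h3
    rw [hγ1, abs_of_nonpos (by linarith [ht.2])] at h4
    rw [abs_of_nonpos (by linarith)]
    linarith
  refine ⟨γ, hγ0, hγ1, fun s hs t ht => ?_⟩
  rw [sub_zero, div_one]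
  rcases le_total s t with h | h
  · exact hmono s hs t ht h
  · rw [W2_comm, abs_sub_comm]
    exact hmono t ht s hs h

/-! ### Weights for two observations -/

variable {q : ℕ}

/-- Evaluating the quadratic form of `A * pinv A * A = A` at `v` gives `c ^ 2 * |v| ^ 4` times the
left side, equal to `c * |v| ^ 4`. -/
theorem dotProduct_pinv_mulVec {v : Fin q → ℝ} (hv : v ≠ 0) {c : ℝ} (hc : c ≠ 0) :
    v ⬝ᵥ (pinv (c • Matrix.vecMulVec v v) *ᵥ v) = c⁻¹ := by
  set P := pinv (c • Matrix.vecMulVec v v) with hP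
  have hA : (c • Matrix.vecMulVec v v).IsHermitian := by
    ext i j
    simp [Matrix.vecMulVec_apply, mul_comm]
  have h := mul_pinv_mul hA
  rw [← hP] at h
  have hvv : v ⬝ᵥ v ≠ 0 := fun h0 => hv (dotProduct_self_eq_zero.1 h0)
  have h1 := congrArg (fun B => v ⬝ᵥ (B *ᵥ v)) h
  simp only [← Matrix.mulVec_mulVec, Matrix.smul_mulVec, Matrix.vecMulVec_mulVec,
    Matrix.mulVec_smul, dotProduct_smul, op_smul_eq_smul, smul_eq_mul] at h1
  field_simp at h1 ⊢
  linarith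

theorem globalWeight_pair {x₁ x₂ : EuclideanSpace ℝ (Fin q)} (hx : x₁ ≠ x₂) (t : ℝ) :
    globalWeight ![x₁, x₂] 0 (x₁ + t • (x₂ - x₁)) = 2 * (1 - t) ∧
      globalWeight ![x₁, x₂] 1 (x₁ + t • (x₂ - x₁)) = 2 * t := by
  set v : Fin q → ℝ := (x₂ - x₁).ofLp with hv
  have hv0 : v ≠ 0 := fun h => hx (sub_eq_zero.1 ((WithLp.ofLp_eq_zero 2).1 h)).symm
  have hmean : sampleMean ![x₁, x₂] = (1 / 2 : ℝ) • (x₁ + x₂) := by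
    simp [sampleMean, Fin.sum_univ_two]
  have h1 : (x₁ - sampleMean ![x₁, x₂]).ofLp = (-(1 / 2) : ℝ) • v := by
    ext i
    simp [hmean, hv]
    ring
  have h2 : (x₂ - sampleMean ![x₁, x₂]).ofLp = (1 / 2 : ℝ) • v := by
    ext i
    simp [hmean, hv]
    ring
  have h3 : (x₁ + t • (x₂ - x₁) - sampleMean ![x₁, x₂]).ofLp = (t - 1 / 2) • v := by
    ext i
    simp [hmean, hv]
    ring
  have hcov : sampleCov ![x₁, x₂] = (1 / 4 : ℝ) • Matrix.vecMulVec v v := by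
    rw [sampleCov, Fin.sum_univ_two]
    simp only [Matrix.cons_val_zero, Matrix.cons_val_one, h1, h2]
    ext i j
    simp [Matrix.vecMulVec_apply]
    ring
  have hP := dotProduct_pinv_mulVec hv0 (c := 1 / 4) (by norm_num)
  rw [← hcov] at hP
  constructor
  · rw [globalWeight, h3, Matrix.cons_val_zero, h1, Matrix.mulVec_smul, dotProduct_smul,
      smul_dotProduct, hP, smul_eq_mul, smul_eq_mul]
    ring
  · rw [globalWeight, h3, Matrix.cons_val_one, Matrix.cons_val_zero, h2, Matrix.mulVec_smul,
      dotProduct_smul, smul_dotProduct, hP, smul_eq_mul, smul_eq_mul]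
    ring

theorem globalObjective_pair {x₁ x₂ : EuclideanSpace ℝ (Fin q)} (hx : x₁ ≠ x₂)
    (ν₁ ν₂ μ : Omega M) (t : ℝ) :
    globalObjective ![x₁, x₂] ![ν₁, ν₂] (x₁ + t • (x₂ - x₁)) μ =
      (1 - t) * W2 μ.1 ν₁.1 ^ 2 + t * W2 μ.1 ν₂.1 ^ 2 := by
  obtain ⟨h1, h2⟩ := globalWeight_pair hx t
  rw [globalObjective, Fin.sum_univ_two, h1, h2]
  simp only [Matrix.cons_val_zero, Matrix.cons_val_one]
  push_cast
  ring

/-! ### Minimizers of the two-point objective -/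

/-- Stewart's theorem as an inequality, for the sides `a, b, w` of a triangle. -/
theorem le_weighted_sq_add_weighted_sq {a b w : ℝ} (ha : 0 ≤ a) (hb : 0 ≤ b) (hw : 0 ≤ w)
    (hab : w ≤ a + b) (hba : b ≤ a + w) (hab' : a ≤ b + w) (t : ℝ) :
    t * (1 - t) * w ^ 2 ≤ (1 - t) * a ^ 2 + t * b ^ 2 := by
  -- In each range of `t`, one triangle inequality bounds the side whose squared term has the
  -- unfavourable sign; what remains is a perfect square.
  rcases lt_or_ge t 0 with ht | ht
  · have h1 : b ^ 2 ≤ (a + w) ^ 2 := pow_le_pow_left₀ hb hba 2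
    nlinarith [sq_nonneg (a + t * w)]
  rcases le_or_gt t 1 with ht1 | ht1
  · have h1 : w ^ 2 ≤ (a + b) ^ 2 := pow_le_pow_left₀ hw hab 2
    have h2 : 0 ≤ t * (1 - t) := mul_nonneg ht (by linarith)
    nlinarith [sq_nonneg ((1 - t) * a - t * b)]
  · have h1 : a ^ 2 ≤ (b + w) ^ 2 := pow_le_pow_left₀ ha hab' 2
    nlinarith [sq_nonneg (b - (t - 1) * w)]

/-- Away from `t = 0` and `t = 1`, both the perfect square and the slack in the triangle inequality
used must vanish. At `t = 0` and `t = 1` one distance is zero, and the triangle inequalities give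
the other. -/
theorem eq_of_weighted_sq_add_weighted_sq {a b w : ℝ} (ha : 0 ≤ a) (hb : 0 ≤ b) (hw : 0 ≤ w)
    (hab : w ≤ a + b) (hba : b ≤ a + w) (hab' : a ≤ b + w) {t : ℝ}
    (h : (1 - t) * a ^ 2 + t * b ^ 2 ≤ t * (1 - t) * w ^ 2) :
    a = |t| * w ∧ b = |1 - t| * w := by
  rcases lt_trichotomy t 0 with ht | rfl | ht
  · have h1 : b ^ 2 ≤ (a + w) ^ 2 := pow_le_pow_left₀ hb hba 2
    have h2 : (a + t * w) ^ 2 ≤ 0 := by nlinarith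
    have h3 : a + t * w = 0 := pow_eq_zero_iff two_ne_zero |>.1 (le_antisymm h2 (sq_nonneg _))
    have h4 : (a + w) ^ 2 ≤ b ^ 2 := by
      have : a = -t * w := by linarith
      subst this
      nlinarith
    have h5 := le_of_sq_le_sq h4 hb
    rw [abs_of_neg ht, abs_of_pos (by linarith)]
    exact ⟨by linarith, by linarith⟩
  · have h1 : a = 0 := pow_eq_zero_iff two_ne_zero |>.1 (le_antisymm (by linarith) (sq_nonneg a))
    subst h1
    simp
    linarith
  rcases lt_trichotomy t 1 with ht1 | rfl | ht1
  · have h1 : w ^ 2 ≤ (a + b) ^ 2 := pow_le_pow_left₀ hw hab 2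
    have h0 : 0 < t * (1 - t) := mul_pos ht (by linarith)
    have h2 : ((1 - t) * a - t * b) ^ 2 ≤ 0 := by nlinarith
    have h3 := pow_eq_zero_iff two_ne_zero |>.1 (le_antisymm h2 (sq_nonneg _))
    have h4 : (a + b) ^ 2 ≤ w ^ 2 := by
      refine le_of_mul_le_mul_left ?_ h0
      nlinarith
    have h5 := le_of_sq_le_sq h4 hw
    have h6 : w = a + b := le_antisymm hab h5
    rw [abs_of_pos ht, abs_of_pos (by linarith), h6]
    exact ⟨by linarith, by linarith⟩
  · have h1 : b = 0 := pow_eq_zero_iff two_ne_zero |>.1 (le_antisymm (by linarith) (sq_nonneg b))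
    subst h1
    simp
    linarith
  · have h1 : a ^ 2 ≤ (b + w) ^ 2 := pow_le_pow_left₀ ha hab' 2
    have h2 : (b - (t - 1) * w) ^ 2 ≤ 0 := by nlinarith
    have h3 := pow_eq_zero_iff two_ne_zero |>.1 (le_antisymm h2 (sq_nonneg _))
    have h4 : (b + w) ^ 2 ≤ a ^ 2 := by
      have : b = (t - 1) * w := by linarith
      subst this
      nlinarith
    have h5 := le_of_sq_le_sq h4 ha
    rw [abs_of_pos (by linarith : 0 < t), abs_of_neg (by linarith)]
    exact ⟨by linarith, by linarith⟩

/-- The measure `μ` attains the lower bound. Any other minimizer has the same two distances, so both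
are McCann's interpolant at `t`. -/
theorem globalEstimate_pair_eq_singleton (hM : IsCompact M) {x₁ x₂ : EuclideanSpace ℝ (Fin q)}
    (hx : x₁ ≠ x₂) {ν₁ ν₂ μ : Omega M} {t : ℝ} (h1 : W2 μ.1 ν₁.1 = |t| * W2 ν₁.1 ν₂.1)
    (h2 : W2 μ.1 ν₂.1 = |1 - t| * W2 ν₁.1 ν₂.1) :
    globalEstimate ![x₁, x₂] ![ν₁, ν₂] (x₁ + t • (x₂ - x₁)) = {μ} := by
  have hval : globalObjective ![x₁, x₂] ![ν₁, ν₂] (x₁ + t • (x₂ - x₁)) μ =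
      t * (1 - t) * W2 ν₁.1 ν₂.1 ^ 2 := by
    rw [globalObjective_pair hx, h1, h2, mul_pow, mul_pow, sq_abs, sq_abs]
    ring
  have htri : ∀ ρ : Omega M, W2 ν₁.1 ν₂.1 ≤ W2 ρ.1 ν₁.1 + W2 ρ.1 ν₂.1 ∧
      W2 ρ.1 ν₂.1 ≤ W2 ρ.1 ν₁.1 + W2 ν₁.1 ν₂.1 ∧
      W2 ρ.1 ν₁.1 ≤ W2 ρ.1 ν₂.1 + W2 ν₁.1 ν₂.1 := fun ρ => by
    refine ⟨?_, W2_triangle hM ρ ν₁ ν₂, ?_⟩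
    · rw [W2_comm ρ.1 ν₁.1]
      exact W2_triangle hM ν₁ ρ ν₂
    · rw [W2_comm ν₁.1 ν₂.1]
      exact W2_triangle hM ρ ν₂ ν₁
  obtain ⟨T, hT⟩ := exists_isOptimalTransportMap hM ν₁ ν₂
  ext ρ
  refine ⟨fun hρ => ?_, ?_⟩
  · have hle := hρ μ
    rw [hval, globalObjective_pair hx] at hle
    obtain ⟨h3, h4⟩ := eq_of_weighted_sq_add_weighted_sq (W2_nonneg _ _) (W2_nonneg _ _)
      (W2_nonneg _ _) (htri ρ).1 (htri ρ).2.1 (htri ρ).2.2 hle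
    exact Subtype.ext ((eq_mcCann_of_W2 hM hT h3 h4).trans (eq_mcCann_of_W2 hM hT h1 h2).symm)
  · rintro rfl ρ'
    rw [hval, globalObjective_pair hx]
    exact le_weighted_sq_add_weighted_sq (W2_nonneg _ _) (W2_nonneg _ _)
      (W2_nonneg _ _) (htri ρ').1 (htri ρ').2.1 (htri ρ').2.2 t

end WassersteinRegression

/-! ### Interpolation and extrapolation -/

theorem corollary1 {d q : ℕ} (M : Set (EuclideanSpace ℝ (Fin d))) (hM : IsCompact M)
    (x₁ x₂ : EuclideanSpace ℝ (Fin q)) (hx : x₁ ≠ x₂)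
    (ν₁ ν₂ : WassersteinRegression.Omega M) :
    -- interpolation
    (∃ T : EuclideanSpace ℝ (Fin d) → EuclideanSpace ℝ (Fin d),
      WassersteinRegression.IsOptimalTransportMap ν₁.1 ν₂.1 T ∧
      (Convex ℝ M → ∃ ν : ℝ → WassersteinRegression.Omega M,
        WassersteinRegression.IsGeodesicFromTo 0 1 ν ν₁ ν₂) ∧
      ∀ ν : ℝ → WassersteinRegression.Omega M,
        WassersteinRegression.IsGeodesicFromTo 0 1 ν ν₁ ν₂ →
        ∀ t ∈ Icc (0 : ℝ) 1,
          (ν t).1 = WassersteinRegression.mcCann ν₁.1 T t ∧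
          WassersteinRegression.globalEstimate ![x₁, x₂] ![ν₁, ν₂]
            (x₁ + t • (x₂ - x₁)) = {ν t}) ∧
    -- extrapolation
    (∀ s₁ s₂ : ℝ, s₁ < 0 → 1 < s₂ → ∀ ν : ℝ → WassersteinRegression.Omega M,
      WassersteinRegression.IsExtendedGeodesic s₁ s₂ ν ν₁ ν₂ →
      (∀ γ : ℝ → WassersteinRegression.Omega M,
        WassersteinRegression.IsGeodesicFromTo s₁ s₂ γ (ν s₁) (ν s₂) →
        ∀ t ∈ Icc s₁ s₂, γ t = ν t) →
      ∀ t ∈ Icc s₁ s₂,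
        WassersteinRegression.globalEstimate ![x₁, x₂] ![ν₁, ν₂]
          (x₁ + t • (x₂ - x₁)) = {ν t}) := by
  open WassersteinRegression in
  obtain ⟨T, hT⟩ := exists_isOptimalTransportMap hM ν₁ ν₂
  refine ⟨⟨T, hT, fun hconv => exists_isGeodesicFromTo hM hconv ν₁ ν₂, ?_⟩, ?_⟩
  · rintro ν ⟨h0, h1, hν⟩ t ht
    have d0 := hν t ht 0 (by simp)
    have d1 := hν t ht 1 (by simp)
    rw [h0, sub_zero, sub_zero, div_one] at d0
    rw [h1, abs_sub_comm, sub_zero, div_one] at d1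
    exact ⟨eq_mcCann_of_W2 hM hT d0 d1, globalEstimate_pair_eq_singleton hM hx d0 d1⟩
  · rintro s₁ s₂ hs₁ hs₂ ν ⟨h0, h1, hν⟩ - t ht
    -- The times 0 and 1 lie in `[s₁, s₂]`, and the distances to the measures there single out the
    -- minimizer.
    have d0 := hν t ht 0 ⟨hs₁.le, by linarith⟩
    have d1 := hν t ht 1 ⟨by linarith, hs₂.le⟩
    rw [h0, sub_zero] at d0
    rw [h1, abs_sub_comm] at d1
    exact globalEstimate_pair_eq_singleton hM hx d0 d1
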